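/- Let $R$ be an integral domain of characteristic $0$, let $F$ be a one-dimensional commutative formal group law over $R$, and let $A=(a_{ij})_{1\le i,j\le n}$ be a generalized Cartan matrix (integers with $a_{ii}=2$, $a_{ij}\le 0$ for $i\ne j$, and $a_{ij}=0\Leftrightarrow a_{ji}=0$). Let $(\mathfrak h,\{\alpha_i\},\{\alpha_i^\vee\})$ be a root datum of $A$: $\mathfrak h$ is a complex vector space of dimension $2n-\operatorname{rank}A$, and the simple roots $\alpha_i\in\mathfrak h^*$ and the simple coroots $\alpha_i^\vee\in\mathfrak h$ are linearly independent families with $\langle\alpha_j,\alpha_i^\vee\rangle=a_{ij}$. Let $W$ be the Weyl group, i.e. the group generated by the reflections $s_i(\lambda)=\lambda-\langle\lambda,\alpha_i^\vee\rangle\alpha_i$ of $\mathfrak h^*$, let $\Phi=\{w(\alpha_i)\mid w\in W,\ 1\le i\le n\}$ be the set of real roots, and put $s_\alpha=ws_iw^{-1}$ for $\alpha=w(\alpha_i)\in\Phi$. Let $\Lambda\subset\mathfrak h^*$ be a Demazure lattice: a finitely generated free abelian subgroup such that $\langle\Lambda,\alpha_i^\vee\rangle\subset\mathbb Z$ for all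 $i$ and such that every simple root is a member of some $\mathbb Z$-basis of $\Lambda$. Let $R[[x_\lambda\mid\lambda\in\Lambda]]$ be the completion of the polynomial ring $R[x_\lambda\mid\lambda\in\Lambda]$ at the ideal generated by all $x_\lambda$, let $J$ be the closure of the ideal generated by $x_0$ and all $x_{\lambda+\mu}-F(x_\lambda,x_\mu)$ with $\lambda,\mu\in\Lambda$, and let $S=R[[\Lambda]]_F=R[[x_\lambda\mid\lambda\in\Lambda]]/J$ be the formal group algebra, on which $W$ acts by $w(x_\lambda)=x_{w(\lambda)}$. Let $Q=S[\tfrac1{x_\alpha}\mid\alpha\in\Phi]$ be the localization of $S$ at all $x_\alpha$, with the induced action of $W$, and let $Q_W$ be the twisted group algebra: the free left $Q$-module with basis $\{\delta_w\}_{w\in W}$ and product $q\delta_w\cdot q'\delta_{w'}=q\,w(q')\,\delta_{ww'}$. It acts on $Q$ by $q\delta_w\cdot q'=q\,w(q')$. Let the formal affine Demazure algebra $\mathbf D_F$ be the $R$-subalgebra of $Q_W$ generated by $S$ and the elements $X_\alpha=\tfrac1{x_\alpha}(1-\delta_{s_\alpha})$, $\alpha\in\Phi$. Then $$\mathbf D_F=\{z\in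 Q_W\mid z\cdot S\subseteq S\},$$ where $S$ on the right denotes the image of $S$ in $Q$. -/

import Mathlib

open Module

noncomputable section

/-! ### Generalized Cartan matrices, root data, Weyl groups, Demazure lattices -/

/-- A generalized Cartan matrix of size `n`. -/
structure GeneralizedCartanMatrix (n : ℕ) where
  entry : Matrix (Fin n) (Fin n) ℤ
  diag : ∀ i, entry i i = 2
  off_diag : ∀ i j, i ≠ j → entry i j ≤ 0
  zero_iff : ∀ i j, entry i j = 0 ↔ entry j i = 0

/-- A root datum `(𝔥, Π, Π^∨)` (a realization) of a generalized Cartan matrix `A`: the complex vector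
space `𝔥` has dimension `2 n - rank A`, and the simple roots `α_i ∈ 𝔥^*` and the simple coroots
`α_i^∨ ∈ 𝔥` are linearly independent families with `⟨α_j, α_i^∨⟩ = a_{ij}`. -/
structure KacMoodyRootDatum {n : ℕ} (A : GeneralizedCartanMatrix n)
    (𝔥 : Type*) [AddCommGroup 𝔥] [Module ℂ 𝔥] where
  finite : FiniteDimensional ℂ 𝔥
  finrank_add_rank : finrank ℂ 𝔥 + (A.entry.map (Int.cast : ℤ → ℂ)).rank = 2 * n
  root : Fin n → Dual ℂ 𝔥
  coroot : Fin n → 𝔥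
  root_indep : LinearIndependent ℂ root
  coroot_indep : LinearIndependent ℂ coroot
  pairing : ∀ i j, root j (coroot i) = (A.entry i j : ℂ)

namespace KacMoodyRootDatum

variable {n : ℕ} {A : GeneralizedCartanMatrix n} {𝔥 : Type*} [AddCommGroup 𝔥] [Module ℂ 𝔥]
  (D : KacMoodyRootDatum A 𝔥)

theorem eval_coroot_root (i : Fin n) : Dual.eval ℂ 𝔥 (D.coroot i) (D.root i) = 2 := by
  simp [D.pairing, A.diag]

/-- The fundamental reflection `s_i : λ ↦ λ - ⟨λ, α_i^∨⟩ α_i` of `𝔥^*`. -/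
def simpleReflection (i : Fin n) : Dual ℂ 𝔥 ≃ₗ[ℂ] Dual ℂ 𝔥 :=
  Module.reflection (D.eval_coroot_root i)

theorem simpleReflection_apply (i : Fin n) (l : Dual ℂ 𝔥) :
    D.simpleReflection i l = l - l (D.coroot i) • D.root i := by
  simp [simpleReflection, Module.reflection_apply]

/-- The Weyl group `W`, generated by the fundamental reflections. -/
def weylGroup : Subgroup (Dual ℂ 𝔥 ≃ₗ[ℂ] Dual ℂ 𝔥) :=
  Subgroup.closure (Set.range D.simpleReflection)

/-- `s_i` as an element of `W`. -/
def s (i : Fin n) : D.weylGroup :=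
  ⟨D.simpleReflection i, Subgroup.subset_closure ⟨i, rfl⟩⟩

/-- The reflection `s_α = w s_i w⁻¹` of the real root `α = w(α_i)`. -/
def rootReflection (w : D.weylGroup) (i : Fin n) : D.weylGroup := w * D.s i * w⁻¹

/-- The set `Φ` of real roots `w(α_i)`. -/
def realRoots : Set (Dual ℂ 𝔥) := {α | ∃ (w : D.weylGroup) (i : Fin n), α = w.1 (D.root i)}

/-- The explicit formula `s_α(λ) = λ - ⟨λ, α^∨⟩ α` for `α = w(α_i)`, `α^∨ = w(α_i^∨)`, where
`⟨λ, w(α_i^∨)⟩ = ⟨w⁻¹(λ), α_i^∨⟩`. -/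
theorem rootReflection_apply (w : D.weylGroup) (i : Fin n) (l : Dual ℂ 𝔥) :
    (D.rootReflection w i).1 l = l - (w⁻¹.1 l) (D.coroot i) • w.1 (D.root i) := by
  have h : w.1 (w⁻¹.1 l) = l := by simp
  simp only [rootReflection, s, Subgroup.coe_mul, LinearEquiv.mul_apply, simpleReflection_apply,
    map_sub, map_smul, h]

end KacMoodyRootDatum

/-- A (formal) Demazure lattice: a finitely generated free abelian subgroup `Λ` of `𝔥^*` with
`⟨Λ, α_i^∨⟩ ⊆ ℤ` for all `i`, such that every simple root is a member of some `ℤ`-basis of `Λ`. -/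
structure DemazureLattice {n : ℕ} {A : GeneralizedCartanMatrix n} {𝔥 : Type*} [AddCommGroup 𝔥]
    [Module ℂ 𝔥] (D : KacMoodyRootDatum A 𝔥) where
  carrier : AddSubgroup (Dual ℂ 𝔥)
  finite : Module.Finite ℤ carrier
  free : Module.Free ℤ carrier
  pairing_int : ∀ l ∈ carrier, ∀ i, ∃ m : ℤ, l (D.coroot i) = (m : ℂ)
  exists_basis : ∀ i, ∃ (k : ℕ) (b : Basis (Fin k) ℤ carrier) (j : Fin k),
    (b j : Dual ℂ 𝔥) = D.root i

namespace DemazureLattice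

variable {n : ℕ} {A : GeneralizedCartanMatrix n} {𝔥 : Type*} [AddCommGroup 𝔥] [Module ℂ 𝔥]
  {D : KacMoodyRootDatum A 𝔥} (L : DemazureLattice D)

theorem root_mem (i : Fin n) : D.root i ∈ L.carrier := by
  obtain ⟨k, b, j, h⟩ := L.exists_basis i
  rw [← h]
  exact (b j).2

theorem smul_mem (w : D.weylGroup) {l : Dual ℂ 𝔥} (hl : l ∈ L.carrier) : w.1 l ∈ L.carrier := by
  have key : ∀ i, ∀ l ∈ L.carrier, D.simpleReflection i l ∈ L.carrier := by
    intro i l hl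
    obtain ⟨m, hm⟩ := L.pairing_int l hl i
    rw [D.simpleReflection_apply, hm, Int.cast_smul_eq_zsmul]
    exact L.carrier.sub_mem hl (L.carrier.zsmul_mem (L.root_mem i) m)
  have hinv : ∀ i, (D.simpleReflection i)⁻¹ = D.simpleReflection i := by
    intro i
    rw [inv_eq_iff_mul_eq_one]
    ext1 l
    exact Module.involutive_reflection (D.eval_coroot_root i) l
  obtain ⟨w, hw⟩ := w
  change w l ∈ L.carrier
  induction hw using Subgroup.closure_induction'' generalizing l with
  | mem x hx => obtain ⟨i, rfl⟩ := hx; exact key i l hl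
  | inv_mem x hx => obtain ⟨i, rfl⟩ := hx; rw [hinv]; exact key i l hl
  | one => exact hl
  | mul x y _ _ ihx ihy => exact ihx (ihy hl)

theorem realRoots_subset : D.realRoots ⊆ L.carrier := by
  rintro _ ⟨w, i, rfl⟩
  exact L.smul_mem w (L.root_mem i)

/-- The Weyl group acts on the Demazure lattice. -/
instance : DistribMulAction D.weylGroup L.carrier where
  smul w l := ⟨w.1 l.1, L.smul_mem w l.2⟩
  one_smul _ := rfl
  mul_smul _ _ _ := rfl
  smul_zero w := Subtype.ext (map_zero w.1)
  smul_add w x y := Subtype.ext (map_add w.1 x.1 y.1)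

/-- The real root `w(α_i)` as an element of the Demazure lattice. -/
def rootElt (w : D.weylGroup) (i : Fin n) : L.carrier :=
  ⟨w.1 (D.root i), L.smul_mem w (L.root_mem i)⟩

end DemazureLattice

/-! ### The formal group algebra -/

section FormalGroupAlgebra

/-- The power series ring `R[[x_σ]]`, i.e. the completion of the polynomial ring `R[x_a | a ∈ σ]` at
the augmentation ideal `(x_a | a ∈ σ)`. -/
abbrev CompletedPolynomial (σ R : Type*) [CommRing R] : Type _ :=
  AdicCompletion (MvPolynomial.idealOfVars σ R) (MvPolynomial σ R)

variable {σ τ υ R : Type*} [CommRing R]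

namespace CompletedPolynomial

/-- The variable `x_a`. -/
def X (R : Type*) [CommRing R] (a : σ) : CompletedPolynomial σ R :=
  AdicCompletion.of _ _ (MvPolynomial.X a)

theorem idealOfVars_pow_le_comap (f : σ → τ) (n : ℕ) :
    MvPolynomial.idealOfVars σ R ^ n ≤
      (MvPolynomial.idealOfVars τ R ^ n).comap (MvPolynomial.rename (R := R) f) := by
  have h : (MvPolynomial.idealOfVars σ R).map (MvPolynomial.rename (R := R) f) ≤
      MvPolynomial.idealOfVars τ R := by
    rw [MvPolynomial.idealOfVars, Ideal.map_span, Ideal.span_le]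
    rintro _ ⟨_, ⟨a, rfl⟩, rfl⟩
    simpa using Ideal.subset_span (Set.mem_range_self (f a))
  rw [← Ideal.map_le_iff_le_comap, Ideal.map_pow]
  exact Ideal.pow_right_mono h n

/-- The substitution of variables `x_a ↦ x_{f a}`, modulo the `n`-th power of the augmentation
ideal. -/
def renameQuot (f : σ → τ) (n : ℕ) :
    (MvPolynomial σ R ⧸ MvPolynomial.idealOfVars σ R ^ n) →ₐ[R]
      (MvPolynomial τ R ⧸ MvPolynomial.idealOfVars τ R ^ n) :=
  Ideal.quotientMapₐ _ (MvPolynomial.rename f) (idealOfVars_pow_le_comap f n)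

theorem renameQuot_compat (f : σ → τ) {m n : ℕ} (hle : m ≤ n) :
    (Ideal.Quotient.factorₐ R (Ideal.pow_le_pow_right hle)).comp
        ((renameQuot f n).comp ((AdicCompletion.evalₐ (MvPolynomial.idealOfVars σ R)
          n).restrictScalars R)) =
      (renameQuot f m).comp ((AdicCompletion.evalₐ (MvPolynomial.idealOfVars σ R)
        m).restrictScalars R) := by
  ext z
  induction z using AdicCompletion.induction_on with
  | h c =>
    simp only [AlgHom.comp_apply, AlgHom.restrictScalars_apply, AdicCompletion.evalₐ_mk,
      ← AdicCompletion.Ideal.mk_eq_mk _ hle c]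
    rfl

/-- The continuous `R`-algebra homomorphism `R[[x_σ]] → R[[x_τ]]` with `x_a ↦ x_{f a}`. -/
def rename (f : σ → τ) : CompletedPolynomial σ R →ₐ[R] CompletedPolynomial τ R :=
  AdicCompletion.liftAlgHom _
    (fun n => (renameQuot f n).comp ((AdicCompletion.evalₐ _ n).restrictScalars R))
    (renameQuot_compat f)

theorem evalₐ_rename (f : σ → τ) (n : ℕ) (z : CompletedPolynomial σ R) :
    AdicCompletion.evalₐ _ n (rename f z) = renameQuot f n (AdicCompletion.evalₐ _ n z) :=
  AdicCompletion.evalₐ_liftAlgHom _ _ (renameQuot_compat f) _ _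

theorem rename_X (f : σ → τ) (a : σ) : rename f (X R a) = X R (f a) := by
  refine AdicCompletion.ext_evalₐ fun n => ?_
  rw [evalₐ_rename, X, X, AdicCompletion.evalₐ_of, AdicCompletion.evalₐ_of]
  simp [renameQuot]

theorem rename_id (z : CompletedPolynomial σ R) : rename id z = z := by
  refine AdicCompletion.ext_evalₐ fun n => ?_
  rw [evalₐ_rename]
  obtain ⟨p, hp⟩ := Ideal.Quotient.mk_surjective (AdicCompletion.evalₐ _ n z)
  rw [← hp]
  simp [renameQuot]

theorem rename_rename (f : σ → τ) (g : τ → υ) (z : CompletedPolynomial σ R) :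
    rename g (rename f z) = rename (g ∘ f) z := by
  refine AdicCompletion.ext_evalₐ fun n => ?_
  rw [evalₐ_rename, evalₐ_rename, evalₐ_rename]
  obtain ⟨p, hp⟩ := Ideal.Quotient.mk_surjective (AdicCompletion.evalₐ _ n z)
  rw [← hp]
  simp [renameQuot, MvPolynomial.rename_rename]

/-- The value `F(x_a, x_b)` in `R[[x_σ]]` of a power series `F` in two variables. -/
def evalTwo (F : MvPowerSeries (Fin 2) R) (a b : σ) : CompletedPolynomial σ R :=
  rename ![a, b] (MvPowerSeries.toAdicCompletion (Fin 2) R F)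

theorem rename_evalTwo (f : σ → τ) (F : MvPowerSeries (Fin 2) R) (a b : σ) :
    rename f (evalTwo F a b) = evalTwo F (f a) (f b) := by
  have h : f ∘ ![a, b] = ![f a, f b] := by
    ext i
    fin_cases i <;> rfl
  rw [evalTwo, rename_rename, h, evalTwo]

/-- The closure of an ideal of `R[[x_σ]]` in the topology of the completion: the kernels of the
projections to `R[x_σ] / (x_σ)^n` are a basis of neighbourhoods of zero, so `z` lies in the closure
of `J` if and only if for every `n` it differs from a member of `J` by a member of the `n`-th
kernel. -/
def closure (J : Ideal (CompletedPolynomial σ R)) : Ideal (CompletedPolynomial σ R) :=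
  ⨅ n : ℕ, J ⊔ RingHom.ker (AdicCompletion.evalₐ (MvPolynomial.idealOfVars σ R) n)

theorem closure_le_comap (f : σ → τ) {J : Ideal (CompletedPolynomial σ R)}
    {J' : Ideal (CompletedPolynomial τ R)} (h : J ≤ J'.comap (rename f)) :
    closure J ≤ (closure J').comap (rename f) := by
  intro z hz
  rw [Ideal.mem_comap, closure, Ideal.mem_iInf]
  intro n
  rw [closure, Ideal.mem_iInf] at hz
  obtain ⟨x, hx, y, hy, rfl⟩ := Submodule.mem_sup.1 (hz n)
  rw [map_add]
  refine Submodule.add_mem_sup (h hx) ?_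
  rw [RingHom.mem_ker] at hy ⊢
  rw [evalₐ_rename, hy, map_zero]

end CompletedPolynomial

/-- The relations `x_0` and `x_{λ+μ} - F(x_λ, x_μ)`. -/
def formalGroupRelations (F : FormalGroup R) (Λ : Type*) [AddCommGroup Λ] :
    Set (CompletedPolynomial Λ R) :=
  {CompletedPolynomial.X R 0} ∪
    {z | ∃ l m : Λ, z = CompletedPolynomial.X R (l + m) -
      CompletedPolynomial.evalTwo F.toPowerSeries l m}

/-- The closure `J` of the ideal generated by the relations. -/
def formalGroupIdeal (F : FormalGroup R) (Λ : Type*) [AddCommGroup Λ] :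
    Ideal (CompletedPolynomial Λ R) :=
  CompletedPolynomial.closure (Ideal.span (formalGroupRelations F Λ))

/-- The formal group algebra `R[[Λ]]_F = R[[x_Λ]] / J`. -/
def FormalGroupAlgebra (F : FormalGroup R) (Λ : Type*) [AddCommGroup Λ] : Type _ :=
  CompletedPolynomial Λ R ⧸ formalGroupIdeal F Λ

instance (F : FormalGroup R) (Λ : Type*) [AddCommGroup Λ] : CommRing (FormalGroupAlgebra F Λ) :=
  inferInstanceAs (CommRing (CompletedPolynomial Λ R ⧸ formalGroupIdeal F Λ))

instance (F : FormalGroup R) (Λ : Type*) [AddCommGroup Λ] : Algebra R (FormalGroupAlgebra F Λ) :=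
  inferInstanceAs (Algebra R (CompletedPolynomial Λ R ⧸ formalGroupIdeal F Λ))

namespace FormalGroupAlgebra

variable (F : FormalGroup R) {Λ : Type*} [AddCommGroup Λ]

/-- The projection `R[[x_Λ]] → R[[Λ]]_F`. -/
def mk : CompletedPolynomial Λ R →ₐ[R] FormalGroupAlgebra F Λ :=
  Ideal.Quotient.mkₐ R (formalGroupIdeal F Λ)

theorem mk_surjective : Function.Surjective (mk F (Λ := Λ)) := Ideal.Quotient.mk_surjective

/-- The element `x_λ` of `R[[Λ]]_F`. -/
def x (l : Λ) : FormalGroupAlgebra F Λ := mk F (CompletedPolynomial.X R l)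

theorem formalGroupIdeal_le_comap (f : Λ →+ Λ) :
    formalGroupIdeal F Λ ≤ (formalGroupIdeal F Λ).comap (CompletedPolynomial.rename f) := by
  refine CompletedPolynomial.closure_le_comap f (Ideal.span_le.2 ?_)
  rintro z (rfl | ⟨l, m, rfl⟩)
  · refine Ideal.subset_span (Or.inl ?_)
    rw [CompletedPolynomial.rename_X, map_zero]
    rfl
  · refine Ideal.subset_span (Or.inr ⟨f l, f m, ?_⟩)
    rw [map_sub, CompletedPolynomial.rename_X, CompletedPolynomial.rename_evalTwo,
      map_add]

/-- The endomorphism of `R[[Λ]]_F` with `x_λ ↦ x_{f λ}` induced by an endomorphism `f` of `Λ`. -/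
def map (f : Λ →+ Λ) : FormalGroupAlgebra F Λ →ₐ[R] FormalGroupAlgebra F Λ :=
  Ideal.quotientMapₐ _ (CompletedPolynomial.rename f) (formalGroupIdeal_le_comap F f)

theorem map_mk (f : Λ →+ Λ) (z : CompletedPolynomial Λ R) :
    map F f (mk F z) = mk F (CompletedPolynomial.rename f z) := rfl

variable {G : Type*} [Group G] [DistribMulAction G Λ]

/-- The action of `G` on `R[[Λ]]_F` with `g(x_λ) = x_{g λ}`. -/
instance : MulSemiringAction G (FormalGroupAlgebra F Λ) where
  smul g := map F (DistribSMul.toAddMonoidHom Λ g)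
  one_smul z := by
    obtain ⟨z, rfl⟩ := mk_surjective F z
    change map F _ _ = _
    have h : ⇑(DistribSMul.toAddMonoidHom Λ (1 : G)) = id := by
      ext l
      simp
    rw [map_mk, h, CompletedPolynomial.rename_id]
  mul_smul g h z := by
    obtain ⟨z, rfl⟩ := mk_surjective F z
    change map F _ _ = map F _ (map F _ _)
    have e : ⇑(DistribSMul.toAddMonoidHom Λ (g * h)) =
        DistribSMul.toAddMonoidHom Λ g ∘ DistribSMul.toAddMonoidHom Λ h := by
      ext l
      simp [mul_smul]
    rw [map_mk, map_mk, map_mk, CompletedPolynomial.rename_rename, e]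
  smul_zero g := map_zero (map F _)
  smul_add g := map_add (map F _)
  smul_one g := map_one (map F _)
  smul_mul g := map_mul (map F _)

theorem smul_def (g : G) (z : FormalGroupAlgebra F Λ) :
    g • z = map F (DistribSMul.toAddMonoidHom Λ g) z := rfl

theorem smul_x (g : G) (l : Λ) : g • x F l = x F (g • l) := by
  rw [smul_def, x, map_mk, CompletedPolynomial.rename_X]
  rfl

theorem smul_algebraMap' (g : G) (r : R) :
    g • algebraMap R (FormalGroupAlgebra F Λ) r = algebraMap R _ r := by
  rw [smul_def, AlgHom.commutes]

end FormalGroupAlgebra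

end FormalGroupAlgebra

/-! ### The localization `Q`, the twisted group algebra `Q_W` and the formal Demazure algebra -/

namespace DemazureLattice

variable {R : Type*} [CommRing R] (F : FormalGroup R) {n : ℕ} {A : GeneralizedCartanMatrix n}
  {𝔥 : Type*} [AddCommGroup 𝔥] [Module ℂ 𝔥] {D : KacMoodyRootDatum A 𝔥} (L : DemazureLattice D)

/-- `S = R[[Λ]]_F`. -/
abbrev S : Type _ := FormalGroupAlgebra F L.carrier

/-- The multiplicative set generated by the elements `x_α`, where `α` runs over the real roots. As
`x_{-α}` is a unit multiple of `x_α` and every real root is positive or negative, inverting it is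
the same as inverting the `x_α` for the positive real roots `α`. -/
def rootSubmonoid : Submonoid (L.S F) :=
  Submonoid.closure {y | ∃ l : L.carrier, (l : Dual ℂ 𝔥) ∈ D.realRoots ∧
    y = FormalGroupAlgebra.x F l}

theorem smul_mem_rootSubmonoid (w : D.weylGroup) {y : L.S F} (hy : y ∈ L.rootSubmonoid F) :
    w • y ∈ L.rootSubmonoid F := by
  induction hy using Submonoid.closure_induction with
  | mem y hy =>
    obtain ⟨l, ⟨v, i, hl⟩, rfl⟩ := hy
    rw [FormalGroupAlgebra.smul_x]
    refine Submonoid.subset_closure ⟨w • l, ⟨w * v, i, ?_⟩, rfl⟩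
    change w.1 l.1 = _
    rw [hl]
    rfl
  | one =>
    rw [smul_one]
    exact one_mem _
  | mul a b _ _ ha hb =>
    rw [smul_mul']
    exact mul_mem ha hb

/-- `Q`, the localization of `S` at all `x_α`. -/
def Q : Type _ := Localization (L.rootSubmonoid F)

instance : CommRing (L.Q F) := inferInstanceAs (CommRing (Localization (L.rootSubmonoid F)))

instance : Algebra (L.S F) (L.Q F) :=
  inferInstanceAs (Algebra (L.S F) (Localization (L.rootSubmonoid F)))

instance : Algebra R (L.Q F) := inferInstanceAs (Algebra R (Localization (L.rootSubmonoid F)))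

instance : IsScalarTower R (L.S F) (L.Q F) :=
  inferInstanceAs (IsScalarTower R (L.S F) (Localization (L.rootSubmonoid F)))

instance : IsLocalization (L.rootSubmonoid F) (L.Q F) :=
  inferInstanceAs (IsLocalization (L.rootSubmonoid F) (Localization (L.rootSubmonoid F)))

/-- The ring endomorphism of `Q` which extends the action of `w` on `S`. -/
def weylMap (w : D.weylGroup) : L.Q F →+* L.Q F :=
  IsLocalization.map (L.Q F) (MulSemiringAction.toRingHom D.weylGroup (L.S F) w)
    (show L.rootSubmonoid F ≤ (L.rootSubmonoid F).comap _ from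
      fun _ hy => L.smul_mem_rootSubmonoid F w hy)

theorem weylMap_algebraMap (w : D.weylGroup) (y : L.S F) :
    L.weylMap F w (algebraMap (L.S F) (L.Q F) y) = algebraMap (L.S F) (L.Q F) (w • y) := by
  rw [weylMap, IsLocalization.map_eq]
  rfl

/-- The Weyl group acts on `Q`. -/
instance : MulSemiringAction D.weylGroup (L.Q F) where
  smul w := L.weylMap F w
  one_smul q := by
    change L.weylMap F 1 q = RingHom.id _ q
    congr 1
    refine IsLocalization.ringHom_ext (L.rootSubmonoid F) (RingHom.ext fun y => ?_)
    simp [weylMap_algebraMap]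
  mul_smul v w q := by
    change L.weylMap F (v * w) q = ((L.weylMap F v).comp (L.weylMap F w)) q
    congr 1
    refine IsLocalization.ringHom_ext (L.rootSubmonoid F) (RingHom.ext fun y => ?_)
    simp [weylMap_algebraMap, mul_smul]
  smul_zero w := map_zero (L.weylMap F w)
  smul_add w := map_add (L.weylMap F w)
  smul_one w := map_one (L.weylMap F w)
  smul_mul w := map_mul (L.weylMap F w)

theorem smul_algebraMap (w : D.weylGroup) (y : L.S F) :
    w • algebraMap (L.S F) (L.Q F) y = algebraMap (L.S F) (L.Q F) (w • y) :=
  L.weylMap_algebraMap F w y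

instance : SMulCommClass D.weylGroup R (L.Q F) where
  smul_comm w r q := by
    have h : w • algebraMap R (L.Q F) r = algebraMap R (L.Q F) r := by
      rw [IsScalarTower.algebraMap_apply R (L.S F) (L.Q F), smul_algebraMap,
        FormalGroupAlgebra.smul_algebraMap']
    rw [Algebra.smul_def, Algebra.smul_def, smul_mul', h]

/-- The twisted group algebra `Q_W`: the free left `Q`-module with basis `δ_w = single w 1` and
multiplication `(q δ_w) (q' δ_{w'}) = q w(q') δ_{w w'}`. -/
abbrev QW : Type _ := SkewMonoidAlgebra (L.Q F) D.weylGroup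

/-- The action of `Q_W` on `Q`: `(∑ q_w δ_w) · q = ∑ q_w w(q)`. -/
def act (z : L.QW F) (q : L.Q F) : L.Q F := z.sum fun w a => a * w • q

/-- `1 / x_α` for the real root `α = w(α_i)`. -/
def invX (w : D.weylGroup) (i : Fin n) : L.Q F :=
  IsLocalization.mk' (M := L.rootSubmonoid F) (L.Q F) 1 ⟨FormalGroupAlgebra.x F (L.rootElt w i),
    Submonoid.subset_closure ⟨L.rootElt w i, ⟨w, i, rfl⟩, rfl⟩⟩

/-- The formal Demazure element `X_α = (1 / x_α) (1 - δ_{s_α})` for the real root `α = w(α_i)`. -/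
def demazureElement (w : D.weylGroup) (i : Fin n) : L.QW F :=
  SkewMonoidAlgebra.single 1 (L.invX F w i) *
    (1 - SkewMonoidAlgebra.single (D.rootReflection w i) 1)

/-- The formal affine Demazure algebra `D_F`: the `R`-subalgebra of `Q_W` generated by the elements
of `S` and by the Demazure elements `X_α` of all real roots `α`. -/
def formalAffineDemazureAlgebra : Subalgebra R (L.QW F) :=
  Algebra.adjoin R
    (Set.range (fun y : L.S F => SkewMonoidAlgebra.single 1 (algebraMap (L.S F) (L.Q F) y)) ∪
      {z | ∃ (w : D.weylGroup) (i : Fin n), z = L.demazureElement F w i})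

end DemazureLattice

end

/-! A ℤ-basis of Λ identifies `S` with a power series ring over `R` (`exists_algEquiv`), in which
the linear part of x_λ records the coordinates of λ. Every real root belongs to a basis, so `S` is a
domain and each x_α is prime. Since s_α acts trivially on `S` modulo x_α, every X_α preserves `S`;
this is the easy inclusion. An element of `Q` that is regular at every x_α lies in `S`
(`exists_algebraMap_eq`).

For the converse let z = ∑ q_w δ_w preserve `S`; fix w and a root α = v(α_i). For u in `S`, the
operator z u − w'(u) z still preserves `S` and has lost its δ_{w'} term. Repeating this leaves only
the terms at w and s_α w, and multiplies q_w by factors w(u) − w'(u). These can be chosen not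
divisible by x_α: in characteristic 0, x_λ ≡ x_μ modulo x_α forces λ − μ ∈ ℤα, and an element of W
that moves every v(α_k) by a multiple of α is 1 or s_α. The two remaining terms show that q_w has at
most a simple pole along x_α, and none if the coefficient at s_α w is zero
(`Preserves.isRegularAt_x_mul`, `Preserves.isRegularAt`).

Now let w have maximal length in the support. If α and w⁻¹(α) are both positive, then s_α w is
longer than w, so its coefficient is zero. Hence q_w has poles only along the inversions of w, and
the product of their x_β clears its denominator. Along a reduced word of w, the product of the
simple Demazure elements has leading coefficient ±1 divided by that product, and its other terms are
shorter. Subtracting `S`-multiples of such products removes the top length from z, and induction on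
the length finishes.

The facts on W that are needed (each real root is positive or negative, the exchange condition) are
derived from the rank two case. -/

noncomputable section

open MvPowerSeries Finsupp

/-! ### Adic filtration of power series rings in finitely many variables. -/

namespace MvPowerSeries

variable {σ R : Type*} [CommRing R] [Finite σ]

/-- For a finitely generated ideal, the kernel of the projection from the completion to the n-th
quotient is generated by the n-th power of the ideal; this is where finiteness of `σ` enters. -/
theorem mem_pow_span_range_X {n : ℕ} {p : MvPowerSeries σ R}
    (hp : ∀ d, degree d < n → coeff d p = 0) :
    p ∈ (Ideal.span (Set.range X) : Ideal (MvPowerSeries σ R)) ^ n := by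
  have hmap : Ideal.map (toAdicCompletionAlgEquiv σ R).toRingEquiv (Ideal.span (Set.range X)) =
    (MvPolynomial.idealOfVars σ R).map
      (algebraMap _ (AdicCompletion (MvPolynomial.idealOfVars σ R) (MvPolynomial σ R))) := by
    simp_rw [Ideal.map_span, ← Set.range_comp]
    congr 2; ext1
    simp [AdicCompletion.algebraMap_apply, ← MvPolynomial.coe_X, toAdicCompletion_coe]
  have h1 : toAdicCompletion σ R p ∈ ((MvPolynomial.idealOfVars σ R) ^ n •
      (⊤ : Submodule (MvPolynomial σ R)
        (AdicCompletion (MvPolynomial.idealOfVars σ R) (MvPolynomial σ R)))) := by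
    rw [AdicCompletion.pow_smul_top_eq_ker_eval (MvPolynomial.idealOfVars_fg σ R),
      LinearMap.mem_ker,
      AdicCompletion.eval_apply, toAdicCompletion_apply_eq_mk_truncTotal]
    have : truncTotal n p = 0 := by
      ext d
      by_cases hd : degree d < n
      · rw [coeff_truncTotal _ hd, hp d hd, MvPolynomial.coeff_zero]
      · rw [coeff_truncTotal_eq_zero _ (not_lt.1 hd), MvPolynomial.coeff_zero]
    rw [this]; rfl
  rw [Ideal.smul_top_eq_map, Submodule.restrictScalars_mem, Ideal.map_pow, ← hmap,
    ← Ideal.map_pow] at h1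
  obtain ⟨q, hq, e⟩ :=
    (Ideal.mem_map_iff_of_surjective _ (toAdicCompletionAlgEquiv σ R).surjective).1 h1
  exact (toAdicCompletionAlgEquiv σ R).injective e ▸ hq

theorem coeff_eq_zero_of_mem_pow {n : ℕ} {p : MvPowerSeries σ R}
    (hp : p ∈ (Ideal.span (Set.range X) : Ideal (MvPowerSeries σ R)) ^ n) {d : σ →₀ ℕ}
    (hd : degree d < n) : coeff d p = 0 := by
  have h1 : (Ideal.span (Set.range X) : Ideal (MvPowerSeries σ R)).map (truncTotalAlgHom σ R n) ≤
      (MvPolynomial.idealOfVars σ R).map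
        (Ideal.Quotient.mk (MvPolynomial.idealOfVars σ R ^ n)) := by
    rw [Ideal.map_span, Ideal.span_le]
    rintro _ ⟨_, ⟨i, rfl⟩, rfl⟩
    rw [← MvPolynomial.coe_X]
    erw [(truncTotalAlgHom σ R n).commutes (MvPolynomial.X i)]
    exact Ideal.mem_map_of_mem _ (Ideal.subset_span ⟨i, rfl⟩)
  have h2 := Ideal.pow_right_mono h1 n
  rw [← Ideal.map_pow, ← Ideal.map_pow, Ideal.map_quotient_self] at h2
  have h3 : truncTotalAlgHom σ R n p = 0 := by simpa using h2 (Ideal.mem_map_of_mem _ hp)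
  rw [truncTotalAlgHom_apply, Ideal.Quotient.eq_zero_iff_mem,
    MvPolynomial.mem_pow_idealOfVars_iff'] at h3
  rw [← coeff_truncTotal _ hd, h3 d hd]

theorem span_range_X_eq_ker : (Ideal.span (Set.range X) : Ideal (MvPowerSeries σ R)) =
    RingHom.ker (constantCoeff (σ := σ) (R := R)) := by
  apply le_antisymm
  · rw [Ideal.span_le]
    rintro _ ⟨i, rfl⟩
    simp
  · intro p hp
    rw [← pow_one (Ideal.span _)]
    refine mem_pow_span_range_X fun d hd => ?_
    obtain rfl : d = 0 := by simpa [Finsupp.degree_eq_zero_iff] using hd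
    simpa using hp

/-- No continuity is assumed: a map sending the variables into a nilpotent ideal kills all series of
order at least N, so it only sees polynomial truncations. -/
theorem algHom_ext_of_nilpotent {B : Type*} [CommRing B] [Algebra R B] {I : Ideal B} {N : ℕ}
    (hI : I ^ N = ⊥) {f g : MvPowerSeries σ R →ₐ[R] B} (hf : ∀ i, f (X i) ∈ I)
    (h : ∀ i, f (X i) = g (X i)) : f = g := by
  have key : ∀ k : MvPowerSeries σ R →ₐ[R] B, (∀ i, k (X i) ∈ I) → ∀ p,
      k p = k (truncTotal N p : MvPolynomial σ R) := by
    intro k hk p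
    rw [← sub_eq_zero, ← map_sub]
    have h1 : p - (truncTotal N p : MvPolynomial σ R) ∈
        (Ideal.span (Set.range X) : Ideal (MvPowerSeries σ R)) ^ N := by
      refine mem_pow_span_range_X fun d hd => ?_
      rw [map_sub, MvPolynomial.coeff_coe, coeff_truncTotal _ hd, sub_self]
    have h2 : (Ideal.span (Set.range X) : Ideal (MvPowerSeries σ R)).map k ≤ I := by
      rw [Ideal.map_span, Ideal.span_le]
      rintro _ ⟨_, ⟨i, rfl⟩, rfl⟩
      exact hk i
    have h3 := Ideal.mem_map_of_mem k h1
    rw [Ideal.map_pow] at h3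
    simpa [hI] using Ideal.pow_right_mono h2 N h3
  have e : f.comp (MvPolynomial.coeToMvPowerSeries.algHom R) =
      g.comp (MvPolynomial.coeToMvPowerSeries.algHom R) := by
    ext i
    simpa using h i
  ext p
  rw [key f hf, key g (fun i => h i ▸ hf i)]
  simpa using DFunLike.congr_fun e (truncTotal N p)

end MvPowerSeries

/-! ### Formal inverses and the group of points of a formal group. -/

namespace FormalGroup
variable {R : Type*} [CommRing R] (F : FormalGroup R)

theorem coeff_single_zero (k : ℕ) :
    coeff (single 0 k) F.toPowerSeries = if k = 1 then 1 else 0 := by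
  have h := congrArg (PowerSeries.coeff k) F.Xzero_eq_X
  rw [PowerSeries.coeff_X] at h
  rw [← h, PowerSeries.coeff, Xzero, PowerSeries.X, coeff_subst HasSubst.X_zero,
    finsum_eq_single _ (single 0 k)]
  · simp [X_pow_eq]
  · intro d hd
    by_cases hd₁ : d 1 = 0
    · have : d 0 ≠ k := by
        rintro rfl
        apply hd
        ext i; fin_cases i <;> simp [hd₁]
      simp [hd₁, X_pow_eq, coeff_monomial]
      intro h
      exact absurd h.symm this
    · simp [hd₁]

/-- F(X, 0) = X makes Y divide F − X, and the quotient has constant term 1. Both the construction of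
inverses and the divisibilities among the x_λ rest on this shape. -/
theorem exists_eq_add_mul : ∃ C D : MvPowerSeries (Fin 2) R,
    F.toPowerSeries = X 0 + X 1 + X 1 * (X 0 * C + X 1 * D) := by
  have h1 : (X 1 : MvPowerSeries (Fin 2) R) ∣ F.toPowerSeries - X 0 := by
    classical
    rw [X_dvd_iff]
    intro m hm
    have e : m = single 0 (m 0) := by ext i; fin_cases i <;> simp [hm]
    rw [e, map_sub, coeff_single_zero, coeff_X]
    simp [Finsupp.single_eq_single_iff]
  obtain ⟨A, hA⟩ := h1
  have h0 : constantCoeff A = 1 := by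
    have := congrArg (coeff (single 1 1)) hA
    rw [map_sub, F.lin_coeff_Y, coeff_index_single_X, X, coeff_monomial_mul, if_pos le_rfl,
      tsub_self] at this
    simpa using this.symm
  have h2 : A - 1 ∈ (Ideal.span (Set.range X) : Ideal (MvPowerSeries (Fin 2) R)) := by
    rw [span_range_X_eq_ker, RingHom.mem_ker, map_sub, h0, map_one, sub_self]
  obtain ⟨c, hc⟩ := Ideal.mem_span_range_iff_exists_fun.1 h2
  refine ⟨c 0, c 1, ?_⟩
  rw [Fin.sum_univ_two] at hc
  linear_combination hA - X 1 * hc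

end FormalGroup

namespace FormalGroup
variable {R : Type*} [CommRing R] (F : FormalGroup R)

theorem hasSubst_pair {σ : Type*} {f g : MvPowerSeries σ R} (hf : constantCoeff f = 0)
    (hg : constantCoeff g = 0) : HasSubst ![f, g] :=
  hasSubst_of_constantCoeff_zero fun i => by fin_cases i <;> simpa

/-- Modulo the n-th power the ideal of the variables is nilpotent, and there the two substitutions
agree on the variables. -/
theorem subst_pair_sub_mem {σ : Type*} [Finite σ] {n : ℕ} {t y z : MvPowerSeries σ R}
    (ht : constantCoeff t = 0) (hy : constantCoeff y = 0) (hz : constantCoeff z = 0)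
    (h : y - z ∈ (Ideal.span (Set.range X) : Ideal (MvPowerSeries σ R)) ^ n)
    (G : MvPowerSeries (Fin 2) R) : G.subst ![t, y] - G.subst ![t, z] ∈
      (Ideal.span (Set.range X) : Ideal (MvPowerSeries σ R)) ^ n := by
  set M := (Ideal.span (Set.range X) : Ideal (MvPowerSeries σ R)) with hM
  have hmem : ∀ {p : MvPowerSeries σ R}, constantCoeff p = 0 → p ∈ M := fun hp => by
    rw [hM, span_range_X_eq_ker]; exact hp
  have e : (Ideal.Quotient.mkₐ R (M ^ n)).comp (substAlgHom (R := R) (hasSubst_pair ht hy)) =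
      (Ideal.Quotient.mkₐ R (M ^ n)).comp (substAlgHom (R := R) (hasSubst_pair ht hz)) := by
    refine algHom_ext_of_nilpotent (I := M.map (Ideal.Quotient.mkₐ R (M ^ n))) (N := n) ?_ ?_ ?_
    · rw [← Ideal.map_pow]
      exact Ideal.map_quotient_self _
    · intro i
      rw [AlgHom.comp_apply, substAlgHom_X]
      refine Ideal.mem_map_of_mem _ (hmem ?_)
      fin_cases i <;> simpa
    · intro i
      rw [AlgHom.comp_apply, substAlgHom_X, AlgHom.comp_apply, substAlgHom_X]
      fin_cases i
      · rfl
      · exact Ideal.Quotient.eq.2 h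
  have := DFunLike.congr_fun e G
  rw [AlgHom.comp_apply, AlgHom.comp_apply, substAlgHom_apply, substAlgHom_apply] at this
  exact Ideal.Quotient.eq.1 this

theorem exists_subst_pair_eq {σ : Type*} : ∃ H : MvPowerSeries (Fin 2) R,
    constantCoeff H = 0 ∧ ∀ f g : MvPowerSeries σ R, constantCoeff f = 0 → constantCoeff g = 0 →
      F.toPowerSeries.subst ![f, g] = f + g + g * H.subst ![f, g] := by
  obtain ⟨C, D, h⟩ := F.exists_eq_add_mul
  refine ⟨X 0 * C + X 1 * D, by simp, fun f g hf hg => ?_⟩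
  have hs := hasSubst_pair hf hg
  rw [h]
  simp only [← substAlgHom_apply hs, map_add, map_mul, substAlgHom_X hs]
  simp

theorem constantCoeff_subst_pair {σ : Type*} {G : MvPowerSeries (Fin 2) R}
    (hG : constantCoeff G = 0)
    {f g : MvPowerSeries σ R} (hf : constantCoeff f = 0) (hg : constantCoeff g = 0) :
    constantCoeff (G.subst ![f, g]) = 0 :=
  constantCoeff_subst_eq_zero (hasSubst_pair hf hg) (fun i => by fin_cases i <;> simpa) hG

/-- The inverse of t is the fixed point of y ↦ y − F(t, y). As F(t, y) = t + y + y H(t, y) with H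
free of constant term, this map is an adic contraction. -/
theorem exists_subst_pair_eq_zero {σ : Type*} [Finite σ] {t : MvPowerSeries σ R}
    (ht : constantCoeff t = 0) :
    ∃ y, constantCoeff y = 0 ∧ F.toPowerSeries.subst ![t, y] = 0 := by
  obtain ⟨H, hH0, hH⟩ := F.exists_subst_pair_eq (σ := σ)
  set M := (Ideal.span (Set.range X) : Ideal (MvPowerSeries σ R)) with hM
  have hmem : ∀ {p : MvPowerSeries σ R}, constantCoeff p = 0 ↔ p ∈ M := by
    intro p
    rw [hM, span_range_X_eq_ker]; rfl
  let φ : MvPowerSeries σ R → MvPowerSeries σ R := fun y => y - F.toPowerSeries.subst ![t, y]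
  have hφ0 : ∀ y, constantCoeff y = 0 → constantCoeff (φ y) = 0 := fun y hy => by
    simp only [φ, map_sub, hy, constantCoeff_subst_pair F.zero_constantCoeff ht hy, sub_zero]
  have hφ : ∀ n y z, constantCoeff y = 0 → constantCoeff z = 0 → y - z ∈ M ^ n →
      φ y - φ z ∈ M ^ (n + 1) := by
    intro n y z hy hz h
    have e : φ y - φ z = -((y - z) * H.subst ![t, y] +
        z * (H.subst ![t, y] - H.subst ![t, z])) := by
      simp only [φ]
      rw [hH t y ht hy, hH t z ht hz]
      ring
    rw [e, pow_succ]
    refine neg_mem (add_mem (Ideal.mul_mem_mul h ?_) ?_)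
    · exact hmem.1 (constantCoeff_subst_pair hH0 ht hy)
    · rw [mul_comm z]
      exact Ideal.mul_mem_mul (subst_pair_sub_mem ht hy hz h H) (hmem.1 hz)
  let u : ℕ → MvPowerSeries σ R := fun n => φ^[n] 0
  have hu : ∀ n, u (n + 1) = φ (u n) := fun n => Function.iterate_succ_apply' φ n 0
  have hu0 : ∀ n, constantCoeff (u n) = 0 := by
    intro n
    induction n with
    | zero => simp [u]
    | succ n ih => rw [hu]; exact hφ0 _ ih
  have hstep : ∀ n, u (n + 1) - u n ∈ M ^ n := by
    intro n
    induction n with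
    | zero => simp
    | succ n ih => rw [hu (n + 1), hu n]; exact hφ _ _ _ (hu n ▸ hu0 _) (hu0 _) (hu n ▸ ih)
  have hcauchy : ∀ {m n}, m ≤ n → u m ≡ u n [SMOD (M ^ m • ⊤ : Ideal (MvPowerSeries σ R))] := by
    intro m n hmn
    rw [SModEq.comm, SModEq.sub_mem, smul_eq_mul, Ideal.mul_top]
    induction n, hmn using Nat.le_induction with
    | base => simp
    | succ n hmn ih =>
      rw [← sub_add_sub_cancel _ (u n)]
      exact add_mem (Ideal.pow_le_pow_right hmn (hstep n)) ih
  obtain ⟨y, hy⟩ := IsPrecomplete.prec (I := M) inferInstance hcauchy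
  have hy' : ∀ n, u n - y ∈ M ^ n := by
    intro n
    simpa [SModEq.sub_mem] using hy n
  have hy0 : constantCoeff y = 0 := by
    rw [hmem]
    rw [← sub_sub_cancel (u 1) y]
    exact sub_mem (hmem.1 (hu0 1)) (pow_one M ▸ hy' 1)
  refine ⟨y, hy0, ?_⟩
  have : φ y - y = 0 := by
    refine IsHausdorff.haus (I := M) inferInstance _ fun n => ?_
    rw [SModEq.sub_mem, smul_eq_mul, Ideal.mul_top, sub_zero, ← neg_mem_iff]
    have h1 := Ideal.pow_le_pow_right (Nat.le_succ n) (hφ n _ _ (hu0 n) hy0 (hy' n))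
    have h2 := Ideal.pow_le_pow_right (Nat.le_succ n) (hy' (n + 1))
    rw [hu] at h2
    simpa using sub_mem h1 h2
  simpa [φ] using this

/-- The correction g H(f, g) to f + g has order at least two. -/
theorem coeff_single_subst_pair {σ : Type*} [DecidableEq σ] {f g : MvPowerSeries σ R}
    (hf : constantCoeff f = 0) (hg : constantCoeff g = 0) (i : σ) :
    coeff (single i 1) (F.toPowerSeries.subst ![f, g]) =
      coeff (single i 1) f + coeff (single i 1) g := by
  obtain ⟨H, hH0, hH⟩ := F.exists_subst_pair_eq (σ := σ)
  rw [hH f g hf hg, map_add, map_add, add_eq_left]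
  refine coeff_of_lt_order ?_
  refine lt_of_lt_of_le ?_ le_order_mul
  have h1 := one_le_order_iff_constCoeff_eq_zero.2 hg
  have h2 := one_le_order_iff_constCoeff_eq_zero.2 (constantCoeff_subst_pair hH0 hf hg)
  refine lt_of_lt_of_le ?_ (add_le_add h1 h2)
  simp
  norm_num

variable [IsDomain R]

theorem Point.constantCoeff_eq_zero {F : FormalGroup R} {σ : Type*} (p : F.Point σ) :
    constantCoeff p.val = 0 :=
  IsNilpotent.eq_zero p.2

/-- A power series with zero constant coefficient as a point of a formal group. -/
def Point.ofConstantCoeff {R : Type*} [CommRing R] (F : FormalGroup R) {σ : Type*}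
    (f : MvPowerSeries σ R) (hf : constantCoeff f = 0) : F.Point σ :=
  ⟨f, PowerSeries.HasSubst.of_constantCoeff_zero hf⟩

/-- Formal inverses turn the commutative monoid of points into an abelian group, and freeness of Λ
supplies the homomorphism. Its values will be the images of the x_λ in the power series ring. -/
theorem exists_addMonoidHom_point [F.IsComm] {ι Λ : Type*} [Finite ι] [AddCommGroup Λ]
    (b : Module.Basis ι ℤ Λ) : ∃ f : Λ →+ F.Point ι, ∀ i, (f (b i)).val = X i := by
  have hinv : ∀ p : F.Point ι, ∃ q : F.Point ι, q + p = 0 := by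
    intro p
    obtain ⟨y, hy, h⟩ := F.exists_subst_pair_eq_zero p.constantCoeff_eq_zero
    exact ⟨Point.ofConstantCoeff F y hy, (add_comm _ _).trans (Subtype.ext h)⟩
  choose neg hneg using hinv
  let _ : Neg (F.Point ι) := ⟨neg⟩
  let _ : AddCommGroup (F.Point ι) :=
    { (inferInstance : AddCommMonoid (F.Point ι)) with
      zsmul := zsmulRec
      neg_add_cancel := hneg }
  refine ⟨(b.constr ℤ fun i => Point.ofConstantCoeff F (X i) (by simp)).toAddMonoidHom,
    fun i => ?_⟩
  have h := Module.Basis.constr_basis b ℤ (fun i => Point.ofConstantCoeff F (X i) (by simp)) i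
  exact congrArg Subtype.val h

end FormalGroup

end

/-! ### Substitution into completed polynomial rings and evaluation at nilpotent ideals. -/

noncomputable section

namespace MvPowerSeries

theorem evalₐ_toAdicCompletion {ι R : Type*} [Finite ι] [CommRing R] (n : ℕ)
    (p : MvPowerSeries ι R) : AdicCompletion.evalₐ _ n (toAdicCompletion ι R p) =
      truncTotalAlgHom ι R n p :=
  AdicCompletion.evalₐ_liftAlgHom _ _ (fun h => AlgHom.ext fun _ => by
    simpa [Ideal.Quotient.mk_eq_mk_iff_sub_mem] using
      truncTotal_sub_truncTotal_mem_pow_idealOfVars h le_rfl _) _ _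

theorem ext_truncTotalAlgHom {ι R : Type*} [Finite ι] [CommRing R] {p q : MvPowerSeries ι R}
    (h : ∀ n, truncTotalAlgHom ι R n p = truncTotalAlgHom ι R n q) : p = q := by
  refine (toAdicCompletionAlgEquiv ι R).injective (AdicCompletion.ext_evalₐ fun n => ?_)
  rw [toAdicCompletionAlgEquiv_apply, toAdicCompletionAlgEquiv_apply, evalₐ_toAdicCompletion,
    evalₐ_toAdicCompletion, h]

theorem truncTotalAlgHom_X {ι R : Type*} [Finite ι] [CommRing R] (n : ℕ) (i : ι) :
    truncTotalAlgHom ι R n (X i) = Ideal.Quotient.mk _ (MvPolynomial.X i) := by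
  rw [← MvPolynomial.coe_X]
  exact (truncTotalAlgHom ι R n).commutes (MvPolynomial.X i)

end MvPowerSeries

namespace CompletedPolynomial

open MvPowerSeries (truncTotalAlgHom toAdicCompletion toAdicCompletionAlgEquiv)

variable {σ ι R : Type*} [CommRing R] [Finite ι]

/-- The substitution of the variables `x_{g i}` into a power series. -/
def evalHom (g : ι → σ) : MvPowerSeries ι R →ₐ[R] CompletedPolynomial σ R :=
  (rename g).comp ((toAdicCompletion ι R).restrictScalars R)

theorem evalTwo_eq (F : MvPowerSeries (Fin 2) R) (a b : σ) : evalTwo F a b = evalHom ![a, b] F :=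
  rfl

theorem evalₐ_evalHom (g : ι → σ) (n : ℕ) (p : MvPowerSeries ι R) :
    AdicCompletion.evalₐ _ n (evalHom g p) = renameQuot g n (truncTotalAlgHom ι R n p) := by
  change AdicCompletion.evalₐ _ n (rename g (toAdicCompletion ι R p)) = _
  rw [evalₐ_rename, MvPowerSeries.evalₐ_toAdicCompletion]

theorem evalHom_X (g : ι → σ) (i : ι) : evalHom g (MvPowerSeries.X i) = X R (g i) := by
  rw [← rename_X]
  change rename g (toAdicCompletion ι R (MvPowerSeries.X i)) = _
  rw [← MvPolynomial.coe_X, MvPowerSeries.toAdicCompletion_coe]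
  rfl

/-- A map out of `R[[x_σ]]` is determined by its values on the variables once it factors through
one of the projections to `R[x_σ] / (x_σ)^n`. -/
theorem algHom_ext_of_ker_le {B : Type*} [CommRing B] [Algebra R B] (n : ℕ)
    {f g : CompletedPolynomial σ R →ₐ[R] B}
    (hf : ∀ z, AdicCompletion.evalₐ (MvPolynomial.idealOfVars σ R) n z = 0 → f z = 0)
    (hg : ∀ z, AdicCompletion.evalₐ (MvPolynomial.idealOfVars σ R) n z = 0 → g z = 0)
    (h : ∀ a, f (X R a) = g (X R a)) : f = g := by
  have e : f.comp ((Algebra.ofId (MvPolynomial σ R) _).restrictScalars R) =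
      g.comp ((Algebra.ofId (MvPolynomial σ R) _).restrictScalars R) := by
    ext a
    exact h a
  ext z
  obtain ⟨p, hp⟩ := Ideal.Quotient.mk_surjective (AdicCompletion.evalₐ _ n z)
  have hz : AdicCompletion.evalₐ (MvPolynomial.idealOfVars σ R) n
      (z - AdicCompletion.of _ _ p) = 0 := by
    rw [map_sub, ← hp, AdicCompletion.evalₐ_of, sub_self]
  have h1 := hf _ hz
  have h2 := hg _ hz
  rw [map_sub, sub_eq_zero] at h1 h2
  rw [h1, h2]
  exact DFunLike.congr_fun e p

/-- The substitution of power series without constant term, modulo `(x)^n`. -/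
def substQuot (f : σ → MvPowerSeries ι R) (hf : ∀ a, MvPowerSeries.constantCoeff (f a) = 0)
    (n : ℕ) : (MvPolynomial σ R ⧸ MvPolynomial.idealOfVars σ R ^ n) →ₐ[R]
      (MvPolynomial ι R ⧸ MvPolynomial.idealOfVars ι R ^ n) :=
  Ideal.Quotient.liftₐ _ (((truncTotalAlgHom ι R n).restrictScalars R).comp (MvPolynomial.aeval f))
    (by
      have h : MvPolynomial.idealOfVars σ R ≤ (Ideal.span (Set.range MvPowerSeries.X)).comap
          (MvPolynomial.aeval (R := R) f) := by
        rw [Ideal.span_le]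
        rintro _ ⟨a, rfl⟩
        simp only [Ideal.coe_comap, Set.mem_preimage, MvPolynomial.aeval_X,
          MvPowerSeries.span_range_X_eq_ker]
        exact hf a
      intro p hp
      have hp' := Ideal.le_comap_pow _ n (Ideal.pow_right_mono h n hp)
      change Ideal.Quotient.mk _ (MvPowerSeries.truncTotal n (MvPolynomial.aeval f p)) = 0
      rw [Ideal.Quotient.eq_zero_iff_mem, MvPolynomial.mem_pow_idealOfVars_iff']
      intro d hd
      rw [MvPowerSeries.coeff_truncTotal _ hd]
      exact MvPowerSeries.coeff_eq_zero_of_mem_pow hp' hd)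

theorem substQuot_mk (f : σ → MvPowerSeries ι R)
    (hf : ∀ a, MvPowerSeries.constantCoeff (f a) = 0) (n : ℕ) (p : MvPolynomial σ R) :
    substQuot f hf n (Ideal.Quotient.mk _ p) =
      truncTotalAlgHom ι R n (MvPolynomial.aeval f p) := rfl

theorem substQuot_compat (f : σ → MvPowerSeries ι R)
    (hf : ∀ a, MvPowerSeries.constantCoeff (f a) = 0) {m n : ℕ} (hle : m ≤ n) :
    (Ideal.Quotient.factorₐ R (Ideal.pow_le_pow_right hle)).comp
        ((substQuot f hf n).comp ((AdicCompletion.evalₐ (MvPolynomial.idealOfVars σ R)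
          n).restrictScalars R)) =
      (substQuot f hf m).comp ((AdicCompletion.evalₐ (MvPolynomial.idealOfVars σ R)
        m).restrictScalars R) := by
  ext z
  induction z using AdicCompletion.induction_on with
  | h c =>
    simp only [AlgHom.comp_apply, AlgHom.restrictScalars_apply, AdicCompletion.evalₐ_mk,
      ← AdicCompletion.Ideal.mk_eq_mk _ hle c, substQuot_mk, MvPowerSeries.truncTotalAlgHom_apply]
    refine Ideal.Quotient.eq.2 ?_
    exact MvPowerSeries.truncTotal_sub_truncTotal_mem_pow_idealOfVars hle le_rfl _

/-- The continuous `R`-algebra homomorphism `R[[x_σ]] → R[[x_ι]]` with `x_a ↦ f a`. -/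
def substHom (f : σ → MvPowerSeries ι R) (hf : ∀ a, MvPowerSeries.constantCoeff (f a) = 0) :
    CompletedPolynomial σ R →ₐ[R] MvPowerSeries ι R :=
  ((toAdicCompletionAlgEquiv ι R).symm.toAlgHom.restrictScalars R).comp
    (AdicCompletion.liftAlgHom _ (fun n => (substQuot f hf n).comp
      ((AdicCompletion.evalₐ _ n).restrictScalars R)) (substQuot_compat f hf))

theorem truncTotalAlgHom_substHom (f : σ → MvPowerSeries ι R)
    (hf : ∀ a, MvPowerSeries.constantCoeff (f a) = 0) (n : ℕ) (z : CompletedPolynomial σ R) :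
    truncTotalAlgHom ι R n (substHom f hf z) =
      substQuot f hf n (AdicCompletion.evalₐ _ n z) := by
  rw [← MvPowerSeries.evalₐ_toAdicCompletion, ← MvPowerSeries.toAdicCompletionAlgEquiv_apply]
  refine (congrArg _ (AlgEquiv.apply_symm_apply _ _)).trans ?_
  exact AdicCompletion.evalₐ_liftAlgHom _ _ (substQuot_compat f hf) _ _

theorem substHom_X (f : σ → MvPowerSeries ι R)
    (hf : ∀ a, MvPowerSeries.constantCoeff (f a) = 0) (a : σ) : substHom f hf (X R a) = f a := by
  refine MvPowerSeries.ext_truncTotalAlgHom fun n => ?_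
  rw [truncTotalAlgHom_substHom, X, AdicCompletion.evalₐ_of, substQuot_mk, MvPolynomial.aeval_X]

end CompletedPolynomial

namespace MvPowerSeries

variable {ι κ R B : Type*} [CommRing R] [CommRing B] [Algebra R B] [Finite ι] [Finite κ]
  {I : Ideal B} {N : ℕ}

/-- The evaluation of a power series at elements of a nilpotent ideal. -/
def nilEval (hI : I ^ N = ⊥) (a : ι → B) (ha : ∀ i, a i ∈ I) : MvPowerSeries ι R →ₐ[R] B :=
  (Ideal.Quotient.liftₐ (MvPolynomial.idealOfVars ι R ^ N) (MvPolynomial.aeval a) (by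
    have h : MvPolynomial.idealOfVars ι R ≤ I.comap (MvPolynomial.aeval (R := R) a) := by
      rw [Ideal.span_le]
      rintro _ ⟨i, rfl⟩
      simpa using ha i
    intro p hp
    simpa [hI] using Ideal.le_comap_pow _ N (Ideal.pow_right_mono h N hp))).comp
    ((truncTotalAlgHom ι R N).restrictScalars R)

theorem nilEval_X (hI : I ^ N = ⊥) (a : ι → B) (ha : ∀ i, a i ∈ I) (i : ι) :
    nilEval (R := R) hI a ha (X i) = a i := by
  rw [nilEval, AlgHom.comp_apply, AlgHom.restrictScalars_apply, truncTotalAlgHom_X]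
  exact MvPolynomial.aeval_X (R := R) a i

theorem eq_nilEval (hI : I ^ N = ⊥) (a : ι → B) (ha : ∀ i, a i ∈ I)
    (f : MvPowerSeries ι R →ₐ[R] B) (hf : ∀ i, f (X i) = a i) : f = nilEval hI a ha :=
  algHom_ext_of_nilpotent hI (fun i => hf i ▸ ha i) fun i => by rw [hf, nilEval_X]

theorem nilEval_mem (hI : I ^ N = ⊥) (a : ι → B) (ha : ∀ i, a i ∈ I) {p : MvPowerSeries ι R}
    (hp : constantCoeff p = 0) : nilEval hI a ha p ∈ I := by
  have hp' : p ∈ (Ideal.span (Set.range X) : Ideal (MvPowerSeries ι R)) := by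
    rw [span_range_X_eq_ker]
    exact hp
  refine (Ideal.span_le.2 ?_ : _ ≤ I.comap (nilEval (R := R) hI a ha)) hp'
  rintro _ ⟨i, rfl⟩
  simpa [nilEval_X] using ha i

theorem nilEval_subst (hI : I ^ N = ⊥) (a : ι → B) (ha : ∀ i, a i ∈ I)
    (g : κ → MvPowerSeries ι R) (hg : ∀ k, constantCoeff (g k) = 0) (p : MvPowerSeries κ R) :
    nilEval hI a ha (p.subst g) =
      nilEval hI (fun k => nilEval hI a ha (g k)) (fun k => nilEval_mem hI a ha (hg k)) p := by
  have hs := hasSubst_of_constantCoeff_zero hg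
  rw [← substAlgHom_apply hs, ← AlgHom.comp_apply]
  refine DFunLike.congr_fun (eq_nilEval hI _ _ _ fun k => ?_) p
  rw [AlgHom.comp_apply, substAlgHom_X]

theorem nilEval_congr (hI : I ^ N = ⊥) {a b : ι → B} (ha : ∀ i, a i ∈ I) (h : a = b)
    (p : MvPowerSeries ι R) : nilEval hI a ha p = nilEval hI b (h ▸ ha) p := by
  subst h
  rfl

end MvPowerSeries

namespace FormalGroup

open MvPowerSeries

variable {R B : Type*} [CommRing R] [CommRing B] [Algebra R B] {I : Ideal B} {N : ℕ}

theorem forall_pair_mem {x y : B} (hx : x ∈ I) (hy : y ∈ I) : ∀ i, ![x, y] i ∈ I := by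
  intro i
  fin_cases i <;> simpa

/-- The formal sum of two elements of a nilpotent ideal. -/
def nilAdd (F : FormalGroup R) (hI : I ^ N = ⊥) (x y : I) : I :=
  ⟨nilEval hI ![(x : B), y] (forall_pair_mem x.2 y.2) F.toPowerSeries,
    nilEval_mem _ _ _ F.zero_constantCoeff⟩

theorem nilAdd_zero (F : FormalGroup R) (hI : I ^ N = ⊥) (x : I) : F.nilAdd hI x 0 = x := by
  have h := F.add_zero (f := (X 0 : MvPowerSeries (Fin 1) R))
    (PowerSeries.HasSubst.of_constantCoeff_zero (by simp))
  have h2 := congrArg (nilEval hI ![(x : B)] (by simp)) h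
  rw [nilEval_subst _ _ _ _ (by intro i; fin_cases i <;> simp), nilEval_X] at h2
  refine Subtype.ext (Eq.trans ?_ h2)
  refine nilEval_congr _ _ ?_ _
  ext i
  fin_cases i <;> simp [nilEval_X]

theorem zero_nilAdd (F : FormalGroup R) (hI : I ^ N = ⊥) (x : I) : F.nilAdd hI 0 x = x := by
  have h := F.zero_add (f := (X 0 : MvPowerSeries (Fin 1) R))
    (PowerSeries.HasSubst.of_constantCoeff_zero (by simp))
  have h2 := congrArg (nilEval hI ![(x : B)] (by simp)) h
  rw [nilEval_subst _ _ _ _ (by intro i; fin_cases i <;> simp), nilEval_X] at h2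
  refine Subtype.ext (Eq.trans ?_ h2)
  refine nilEval_congr _ _ ?_ _
  ext i
  fin_cases i <;> simp [nilEval_X]

theorem nilEval_subst_pair (F : FormalGroup R) (hI : I ^ N = ⊥) {ι : Type*} [Finite ι] (a : ι → B)
    (ha : ∀ i, a i ∈ I) {f g : MvPowerSeries ι R} (hf : constantCoeff f = 0)
    (hg : constantCoeff g = 0) : nilEval hI a ha (F.toPowerSeries.subst ![f, g]) =
      F.nilAdd hI ⟨nilEval hI a ha f, nilEval_mem _ _ _ hf⟩
        ⟨nilEval hI a ha g, nilEval_mem _ _ _ hg⟩ := by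
  rw [nilEval_subst _ _ _ _ (by intro i; fin_cases i <;> simpa)]
  refine nilEval_congr _ _ ?_ _
  ext i
  fin_cases i <;> simp

theorem nilAdd_assoc (F : FormalGroup R) (hI : I ^ N = ⊥) (x y z : I) :
    F.nilAdd hI (F.nilAdd hI x y) z = F.nilAdd hI x (F.nilAdd hI y z) := by
  have h : ∀ i, ![(x : B), y, z] i ∈ I := by
    intro i
    fin_cases i <;> simp
  have h0 : ∀ i, constantCoeff (X i : MvPowerSeries (Fin 3) R) = 0 := fun i => by simp
  have h1 : ∀ i j,
      constantCoeff (F.toPowerSeries.subst ![X i, (X j : MvPowerSeries (Fin 3) R)]) = 0 :=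
    fun i j => constantCoeff_subst_pair F.zero_constantCoeff (h0 i) (h0 j)
  have := congrArg (nilEval hI ![(x : B), y, z] h) F.assoc
  rw [nilEval_subst_pair _ _ _ _ (h1 0 1) (h0 2),
    nilEval_subst_pair _ _ _ _ (h0 0) (h1 1 2)] at this
  simp only [nilEval_subst_pair _ _ _ _ (h0 0) (h0 1), nilEval_subst_pair _ _ _ _ (h0 1) (h0 2),
    nilEval_X] at this
  exact Subtype.ext this

/-- Two maps from an abelian group to a nilpotent ideal which are additive for the formal sum are
equal if they agree on a generating set. -/
theorem eq_of_nilAdd (F : FormalGroup R) (hI : I ^ N = ⊥) {Λ : Type*} [AddCommGroup Λ] {u v : Λ → I}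
    (hu0 : u 0 = 0) (hv0 : v 0 = 0) (hu : ∀ a b, u (a + b) = F.nilAdd hI (u a) (u b))
    (hv : ∀ a b, v (a + b) = F.nilAdd hI (v a) (v b)) {s : Set Λ}
    (hs : AddSubgroup.closure s = ⊤) (h : ∀ a ∈ s, u a = v a) (a : Λ) : u a = v a := by
  have ha : a ∈ AddSubgroup.closure s := hs ▸ AddSubgroup.mem_top a
  induction ha using AddSubgroup.closure_induction with
  | mem a ha => exact h a ha
  | zero => rw [hu0, hv0]
  | add a b _ _ ha hb => rw [hu, hv, ha, hb]
  | neg a _ ha =>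
    -- Uniqueness of inverses: for the formal sum, u(−a) = u(−a) + (u(a) + v(−a)) = v(−a).
    have e1 : F.nilAdd hI (u (-a)) (u a) = 0 := by rw [← hu, neg_add_cancel, hu0]
    have e2 : F.nilAdd hI (u a) (v (-a)) = 0 := by rw [ha, ← hv, add_neg_cancel, hv0]
    rw [← F.nilAdd_zero hI (u (-a)), ← e2, ← F.nilAdd_assoc, e1, F.zero_nilAdd]

end FormalGroup

end

/-! ### The formal group algebra as a power series ring. -/

noncomputable section

namespace CompletedPolynomial

open MvPowerSeries (truncTotalAlgHom)

variable {σ ι R : Type*} [CommRing R] [Finite ι]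

theorem substHom_evalHom (f : σ → MvPowerSeries ι R)
    (hf : ∀ a, MvPowerSeries.constantCoeff (f a) = 0) {κ : Type*} [Finite κ] (g : κ → σ)
    (p : MvPowerSeries κ R) : substHom f hf (evalHom g p) = p.subst (f ∘ g) := by
  have hs := MvPowerSeries.hasSubst_of_constantCoeff_zero (a := f ∘ g) fun k => hf (g k)
  refine MvPowerSeries.ext_truncTotalAlgHom fun n => ?_
  have hI : (MvPolynomial.idealOfVars ι R).map
      (Ideal.Quotient.mk (MvPolynomial.idealOfVars ι R ^ n)) ^ n = ⊥ := by
    rw [← Ideal.map_pow, Ideal.map_quotient_self]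
  have e : (((truncTotalAlgHom ι R n).restrictScalars R).comp (substHom f hf)).comp (evalHom g) =
      ((truncTotalAlgHom ι R n).restrictScalars R).comp (MvPowerSeries.substAlgHom hs) := by
    refine MvPowerSeries.algHom_ext_of_nilpotent hI (fun k => ?_) fun k => ?_
    · simp only [AlgHom.comp_apply, evalHom_X, substHom_X]
      have h1 : f (g k) ∈ (Ideal.span (Set.range MvPowerSeries.X) : Ideal (MvPowerSeries ι R)) := by
        rw [MvPowerSeries.span_range_X_eq_ker]
        exact hf _
      refine (Ideal.span_le.2 ?_ : _ ≤ Ideal.comap ((truncTotalAlgHom ι R n).restrictScalars R)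
        ((MvPolynomial.idealOfVars ι R).map (Ideal.Quotient.mk _))) h1
      rintro _ ⟨i, rfl⟩
      rw [SetLike.mem_coe, Ideal.mem_comap, AlgHom.restrictScalars_apply,
        MvPowerSeries.truncTotalAlgHom_X]
      exact Ideal.mem_map_of_mem _ (Ideal.subset_span ⟨i, rfl⟩)
    · simp only [AlgHom.comp_apply, evalHom_X, substHom_X, MvPowerSeries.substAlgHom_X]
      rfl
  rw [← MvPowerSeries.substAlgHom_apply hs]
  exact DFunLike.congr_fun e p

theorem evalₐ_evalHom_substHom (f : σ → MvPowerSeries ι R)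
    (hf : ∀ a, MvPowerSeries.constantCoeff (f a) = 0) (g : ι → σ) {n : ℕ}
    {z : CompletedPolynomial σ R}
    (hz : AdicCompletion.evalₐ (MvPolynomial.idealOfVars σ R) n z = 0) :
    AdicCompletion.evalₐ _ n (evalHom g (substHom f hf z)) = 0 := by
  rw [evalₐ_evalHom, truncTotalAlgHom_substHom, hz, map_zero, map_zero]

theorem substHom_eq_zero_of_mem_closure (f : σ → MvPowerSeries ι R)
    (hf : ∀ a, MvPowerSeries.constantCoeff (f a) = 0) {J : Ideal (CompletedPolynomial σ R)}
    (hJ : J ≤ RingHom.ker (substHom f hf)) {z : CompletedPolynomial σ R} (hz : z ∈ closure J) :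
    substHom f hf z = 0 := by
  refine MvPowerSeries.ext_truncTotalAlgHom fun n => ?_
  obtain ⟨x, hx, y, hy, rfl⟩ := Submodule.mem_sup.1 (Ideal.mem_iInf.1 hz n)
  rw [map_add, RingHom.mem_ker.1 (hJ hx), zero_add, truncTotalAlgHom_substHom,
    RingHom.mem_ker.1 hy, map_zero, map_zero]

end CompletedPolynomial

namespace FormalGroupAlgebra

open CompletedPolynomial
open MvPowerSeries (constantCoeff nilEval)

variable {R : Type*} [CommRing R] (F : FormalGroup R) {Λ : Type*} [AddCommGroup Λ]
  {ι : Type*} [Finite ι]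

theorem formalGroupIdeal_le_ker {f : Λ → MvPowerSeries ι R} (hf : ∀ a, constantCoeff (f a) = 0)
    (h0 : f 0 = 0) (hadd : ∀ a b, f (a + b) = F.toPowerSeries.subst ![f a, f b]) :
    formalGroupIdeal F Λ ≤ RingHom.ker (substHom f hf) := by
  intro z hz
  refine substHom_eq_zero_of_mem_closure f hf ?_ hz
  rw [Ideal.span_le]
  rintro _ (rfl | ⟨a, b, rfl⟩)
  · exact (substHom_X f hf 0).trans h0
  · change substHom f hf _ = 0
    have e : f ∘ ![a, b] = ![f a, f b] := by
      ext1 i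
      fin_cases i <;> rfl
    rw [map_sub, substHom_X, evalTwo_eq, substHom_evalHom, e, hadd, sub_self]

/-- Modulo the relations and the n-th kernel, x_a equals the series f a evaluated at the x_{b i}:
both are additive for the formal sum in a nilpotent ideal and they agree on the basis. Hence each
such quotient map factors through `substHom f hf`, and letting n vary gives membership in the
closure. -/
theorem ker_substHom_le {f : Λ → MvPowerSeries ι R} (hf : ∀ a, constantCoeff (f a) = 0)
    (h0 : f 0 = 0) (hadd : ∀ a b, f (a + b) = F.toPowerSeries.subst ![f a, f b])
    (b : Basis ι ℤ Λ) (hb : ∀ i, f (b i) = MvPowerSeries.X i) :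
    RingHom.ker (substHom f hf) ≤ formalGroupIdeal F Λ := by
  intro z hz
  refine Ideal.mem_iInf.2 fun n => ?_
  set K := Ideal.span (formalGroupRelations F Λ) ⊔
    RingHom.ker (AdicCompletion.evalₐ (MvPolynomial.idealOfVars Λ R) n) with hK
  have hker : ∀ y, AdicCompletion.evalₐ (MvPolynomial.idealOfVars Λ R) n y = 0 → y ∈ K :=
    fun y hy => Ideal.mem_sup_right hy
  let q : CompletedPolynomial Λ R →ₐ[R] CompletedPolynomial Λ R ⧸ K := Ideal.Quotient.mkₐ R K
  have hq : ∀ y, y ∈ K → q y = 0 := fun y hy => Ideal.Quotient.eq_zero_iff_mem.2 hy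
  let I := (MvPolynomial.idealOfVars Λ R).map (q.toRingHom.comp (algebraMap (MvPolynomial Λ R) _))
  have hI : I ^ n = ⊥ := by
    rw [← Ideal.map_pow, ← le_bot_iff, Ideal.map_le_iff_le_comap]
    intro p hp
    refine hq _ (hker _ ?_)
    change AdicCompletion.evalₐ _ n (AdicCompletion.of _ _ p) = 0
    rw [AdicCompletion.evalₐ_of]
    exact Ideal.Quotient.eq_zero_iff_mem.2 hp
  have hX : ∀ a, q (X R a) ∈ I := fun a =>
    Ideal.mem_map_of_mem _ (Ideal.subset_span ⟨a, rfl⟩)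
  have hψX : ∀ i, (q.comp (evalHom b)) (MvPowerSeries.X i) ∈ I := fun i => by
    rw [AlgHom.comp_apply, evalHom_X]
    exact hX _
  have hψ : q.comp (evalHom b) = nilEval hI _ hψX := MvPowerSeries.eq_nilEval hI _ _ _ fun _ => rfl
  have hmem : ∀ a, q (evalHom b (f a)) ∈ I := fun a => by
    rw [← AlgHom.comp_apply, hψ]
    exact MvPowerSeries.nilEval_mem _ _ _ (hf a)
  have key : ∀ a, q (X R a) = q (evalHom b (f a)) := by
    intro a
    refine congrArg Subtype.val (F.eq_of_nilAdd hI (u := fun a => ⟨q (X R a), hX a⟩)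
      (v := fun a => ⟨q (evalHom b (f a)), hmem a⟩) ?_ ?_ ?_ ?_ (s := Set.range b) ?_ ?_ a)
    · exact Subtype.ext (hq _ (Ideal.mem_sup_left (Ideal.subset_span (Or.inl rfl))))
    · exact Subtype.ext (by simp [h0])
    · intro a c
      refine Subtype.ext ?_
      have h1 : q (X R (a + c)) = q (evalTwo F.toPowerSeries a c) :=
        Ideal.Quotient.eq.2 (Ideal.mem_sup_left (Ideal.subset_span (Or.inr ⟨a, c, rfl⟩)))
      refine h1.trans ?_
      rw [evalTwo_eq, ← AlgHom.comp_apply]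
      refine DFunLike.congr_fun (MvPowerSeries.eq_nilEval hI _ _ _ fun i => ?_) _
      rw [AlgHom.comp_apply, evalHom_X]
      fin_cases i <;> rfl
    · intro a c
      refine Subtype.ext ?_
      have := F.nilEval_subst_pair hI _ hψX (hf a) (hf c)
      rw [← hadd] at this
      simp only [← hψ] at this
      exact this
    · rw [← Submodule.span_int_eq_addSubgroupClosure, b.span_eq]
      rfl
    · rintro _ ⟨i, rfl⟩
      refine Subtype.ext ?_
      change q _ = q _
      rw [hb, evalHom_X]
  have e : q = (q.comp (evalHom b)).comp (substHom f hf) := by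
    refine algHom_ext_of_ker_le n (fun y hy => hq _ (hker _ hy)) (fun y hy => ?_) fun a => ?_
    · exact hq _ (hker _ (evalₐ_evalHom_substHom f hf b hy))
    · rw [AlgHom.comp_apply, substHom_X]
      exact key a
  have := DFunLike.congr_fun e z
  rw [AlgHom.comp_apply, RingHom.mem_ker.1 hz, map_zero] at this
  exact Ideal.Quotient.eq_zero_iff_mem.1 this

/-- The formal group algebra of a free abelian group of finite rank is a power series ring. -/
theorem exists_algEquiv [IsDomain R] [F.IsComm] (b : Basis ι ℤ Λ) :
    ∃ e : FormalGroupAlgebra F Λ ≃ₐ[R] MvPowerSeries ι R,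
      (∀ i, e (x F (b i)) = MvPowerSeries.X i) ∧ (∀ a, constantCoeff (e (x F a)) = 0) ∧
      ∀ a i, MvPowerSeries.coeff (Finsupp.single i 1) (e (x F a)) = (b.repr a i : R) := by
  classical
  obtain ⟨f, hfb⟩ := F.exists_addMonoidHom_point b
  let c : Λ → MvPowerSeries ι R := fun a => (f a).val
  have hc : ∀ a, constantCoeff (c a) = 0 := fun a => (f a).constantCoeff_eq_zero
  have h0 : c 0 = 0 := congrArg Subtype.val (map_zero f)
  have hadd : ∀ a b, c (a + b) = F.toPowerSeries.subst ![c a, c b] := fun a b =>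
    congrArg Subtype.val (map_add f a b)
  have hker : formalGroupIdeal F Λ = RingHom.ker (substHom c hc) :=
    le_antisymm (formalGroupIdeal_le_ker F hc h0 hadd) (ker_substHom_le F hc h0 hadd b hfb)
  have hsurj : Function.Surjective (substHom c hc) := by
    intro p
    refine ⟨evalHom b p, ?_⟩
    have e : c ∘ b = MvPowerSeries.X := funext hfb
    rw [substHom_evalHom, e, MvPowerSeries.subst_self]
    rfl
  let e : FormalGroupAlgebra F Λ ≃ₐ[R] MvPowerSeries ι R :=
    (Ideal.quotientEquivAlgOfEq R hker).trans (Ideal.quotientKerAlgEquivOfSurjective hsurj)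
  have he : ∀ a, e (x F a) = c a := fun a => substHom_X c hc a
  refine ⟨e, fun i => (he _).trans (hfb i), fun a => by rw [he, hc], fun a i => ?_⟩
  rw [he]
  -- The linear coefficient is additive in a, so it need only be compared with the coordinate on the
  -- basis.
  let l : Λ →+ R :=
    { toFun := fun a => MvPowerSeries.coeff (Finsupp.single i 1) (c a)
      map_zero' := by rw [h0, map_zero]
      map_add' := fun a b => by rw [hadd, F.coeff_single_subst_pair (hc a) (hc b)] }
  let l' : Λ →+ R := (Int.castAddHom R).comp (b.coord i).toAddMonoidHom
  have hl : l.toIntLinearMap = l'.toIntLinearMap := by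
    refine b.ext fun j => ?_
    change MvPowerSeries.coeff (Finsupp.single i 1) (c (b j)) = ((b.repr (b j) i : ℤ) : R)
    rw [show c (b j) = MvPowerSeries.X j from hfb j, MvPowerSeries.coeff_index_single_X,
      b.repr_self, Finsupp.single_apply]
    by_cases h : i = j
    · simp [h]
    · simp [h, Ne.symm h]
  exact LinearMap.congr_fun hl a

end FormalGroupAlgebra

end

/-! ### Primality and divisibility in the formal group algebra. -/

noncomputable section

namespace MvPowerSeries

/-- Singling out the variable i presents the ring as one-variable power series over a domain. -/
theorem prime_X {ι R : Type*} [CommRing R] [IsDomain R] (i : ι) :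
    Prime (X i : MvPowerSeries ι R) := by
  classical
  let e := (renameEquiv R (Equiv.optionSubtypeNe i).symm).trans (optionEquivLeft _ R)
  have he : e (X i) = PowerSeries.X := by
    change optionEquivLeft _ R (rename _ (X i)) = _
    rw [rename_X, Equiv.optionSubtypeNe_symm_self, optionEquivLeft_X_none]
  rw [← MulEquiv.prime_iff e.toMulEquiv]
  change Prime (e (X i))
  rw [he]
  have : IsDomain (MvPowerSeries {a // a ≠ i} R) := NoZeroDivisors.to_isDomain _
  exact PowerSeries.X_prime

/-- The ideal of a variable is closed: a coefficient of degree d is unaffected by the (d + 1)-st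
power of the ideal of all variables. -/
theorem X_dvd_of_forall_mem_sup {ι R : Type*} [CommRing R] [Finite ι] {j : ι}
    {p : MvPowerSeries ι R}
    (h : ∀ n, p ∈ Ideal.span {X j} ⊔ (Ideal.span (Set.range X) : Ideal (MvPowerSeries ι R)) ^ n) :
    X j ∣ p := by
  rw [X_dvd_iff]
  intro d hd
  obtain ⟨y, hy, z, hz, rfl⟩ := Submodule.mem_sup.1 (h (d.degree + 1))
  rw [map_add, coeff_eq_zero_of_mem_pow hz (Nat.lt_succ_self _), add_zero]
  exact X_dvd_iff.1 (Ideal.mem_span_singleton.1 hy) d hd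

end MvPowerSeries

namespace FormalGroupAlgebra

open CompletedPolynomial
open MvPowerSeries (constantCoeff)

section relations

variable {R : Type*} [CommRing R] (F : FormalGroup R) {Λ : Type*} [AddCommGroup Λ]

theorem x_zero : x F (0 : Λ) = 0 :=
  Ideal.Quotient.eq_zero_iff_mem.2 (Ideal.mem_iInf.2 fun _ =>
    Ideal.mem_sup_left (Ideal.subset_span (Or.inl rfl)))

theorem x_add (a b : Λ) : ∃ c d, x F (a + b) = x F a + x F b + x F b * (x F a * c + x F b * d) := by
  obtain ⟨C, D, h⟩ := F.exists_eq_add_mul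
  have e : x F (a + b) = mk F (evalTwo F.toPowerSeries a b) :=
    Ideal.Quotient.eq.2 (Ideal.mem_iInf.2 fun _ =>
      Ideal.mem_sup_left (Ideal.subset_span (Or.inr ⟨a, b, rfl⟩)))
  refine ⟨mk F (evalHom ![a, b] C), mk F (evalHom ![a, b] D), ?_⟩
  rw [e, evalTwo_eq, h]
  simp only [map_add, map_mul, evalHom_X]
  rfl

theorem x_dvd_x_add_sub (a b : Λ) : x F b ∣ x F (a + b) - x F a := by
  obtain ⟨c, d, h⟩ := x_add F a b
  exact ⟨1 + (x F a * c + x F b * d), by rw [h]; ring⟩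

theorem x_dvd_x_neg (a : Λ) : x F a ∣ x F (-a) := by
  have := x_dvd_x_add_sub F (-a) a
  rwa [neg_add_cancel, x_zero, zero_sub, dvd_neg] at this

theorem x_dvd_x_zsmul (m : ℤ) (a : Λ) : x F a ∣ x F (m • a) := by
  have h : ∀ k : ℕ, x F a ∣ x F (k • a) := by
    intro k
    induction k with
    | zero => simp [x_zero]
    | succ k ih =>
      rw [succ_nsmul]
      exact (dvd_iff_dvd_of_dvd_sub (x_dvd_x_add_sub F _ _)).2 ih
  obtain ⟨k, rfl | rfl⟩ := m.eq_nat_or_neg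
  · rw [natCast_zsmul]
    exact h k
  · rw [neg_smul, natCast_zsmul]
    exact (h k).trans (x_dvd_x_neg F _)

theorem x_dvd_x_add_zsmul_sub (a b : Λ) (m : ℤ) : x F b ∣ x F (a + m • b) - x F a :=
  (x_dvd_x_zsmul F m b).trans (x_dvd_x_add_sub F _ _)

end relations

variable {R : Type*} [CommRing R] [IsDomain R] (F : FormalGroup R) [F.IsComm]
  {Λ : Type*} [AddCommGroup Λ] {ι : Type*} [Finite ι] (b : Basis ι ℤ Λ)

theorem isDomain_of_basis {ι : Type*} [Finite ι] (b : Basis ι ℤ Λ) :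
    IsDomain (FormalGroupAlgebra F Λ) := by
  obtain ⟨e, -⟩ := exists_algEquiv F b
  have : IsDomain (MvPowerSeries ι R) := NoZeroDivisors.to_isDomain _
  exact MulEquiv.isDomain _ e.toMulEquiv

theorem prime_x (j : ι) : Prime (x F (b j)) := by
  obtain ⟨e, h, -⟩ := exists_algEquiv F b
  rw [← MulEquiv.prime_iff e.toMulEquiv]
  change Prime (e _)
  rw [h]
  exact MvPowerSeries.prime_X j

/-- Divisibility by one variable kills the linear coefficients at all others. These are the integer
coordinates of l − m read in `R`, so characteristic 0 makes the coordinates themselves vanish. -/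
theorem exists_zsmul_eq_of_x_dvd [CharZero R] {j : ι} {l m : Λ} (hd : x F (b j) ∣ x F l - x F m) :
    ∃ k : ℤ, l - m = k • b j := by
  classical
  obtain ⟨e, h, -, hc⟩ := exists_algEquiv F b
  have h1 := map_dvd e hd
  rw [h, MvPowerSeries.X_dvd_iff] at h1
  refine ⟨b.repr (l - m) j, b.repr.injective (Finsupp.ext fun i => ?_)⟩
  rw [map_smul, b.repr_self, Finsupp.smul_apply, Finsupp.single_apply]
  by_cases hij : j = i
  · simp [hij]
  · have := h1 (Finsupp.single i 1) (Finsupp.single_eq_of_ne hij)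
    rw [map_sub, map_sub, hc, hc, sub_eq_zero, Int.cast_inj] at this
    simp [hij, this]

theorem not_x_dvd_two [CharZero R] (j : ι) : ¬ x F (b j) ∣ 2 := by
  obtain ⟨e, h, -⟩ := exists_algEquiv F b
  intro hd
  have h1 := map_dvd e hd
  rw [h, MvPowerSeries.X_dvd_iff] at h1
  have := h1 0 rfl
  rw [map_ofNat, MvPowerSeries.coeff_zero_eq_constantCoeff_apply, map_ofNat] at this
  exact two_ne_zero this

/-- If x_{−b} = u x_b, then F(x_b, x_{−b}) = 0 gives u ≡ −1 modulo x_b, so the cofactor 1 − u is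
congruent to 2, which x_b does not divide in characteristic 0. -/
theorem exists_x_sub_x_neg_eq [CharZero R] (j : ι) :
    ∃ v, x F (b j) - x F (-b j) = x F (b j) * v ∧ ¬ x F (b j) ∣ v := by
  obtain ⟨c, d, h⟩ := x_add F (b j) (-b j)
  obtain ⟨u, hu⟩ := x_dvd_x_neg F (b j)
  rw [add_neg_cancel, x_zero, hu] at h
  have := isDomain_of_basis F b
  have h0 : 1 + u * (1 + x F (b j) * (c + u * d)) = 0 := by
    refine (mul_eq_zero.1 (?_ : x F (b j) * _ = 0)).resolve_left (prime_x F b j).ne_zero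
    linear_combination -h
  refine ⟨1 - u, by rw [hu]; ring, fun hd => not_x_dvd_two F b j ?_⟩
  have e : (2 : FormalGroupAlgebra F Λ) = (1 - u) - x F (b j) * (u * (c + u * d)) := by
    linear_combination h0
  rw [e]
  exact dvd_sub hd (dvd_mul_right _ _)

/-- Modulo x_{b j} the map fixes every variable x_{b i}, hence fixes every series modulo x_{b j} and
any power of the ideal of the variables; the ideal of x_{b j} is closed. -/
theorem x_dvd_map_sub {j : ι} {g : Λ →+ Λ} (hg : ∀ l, ∃ m : ℤ, g l = l + m • b j)
    (y : FormalGroupAlgebra F Λ) : x F (b j) ∣ map F g y - y := by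
  obtain ⟨e, h, h0, -⟩ := exists_algEquiv F b
  rw [← map_dvd_iff e, h, map_sub]
  refine MvPowerSeries.X_dvd_of_forall_mem_sup fun n => ?_
  set M : Ideal (MvPowerSeries ι R) := Ideal.span (Set.range MvPowerSeries.X)
  set K := Ideal.span {MvPowerSeries.X j} ⊔ M ^ n with hK
  let q : MvPowerSeries ι R →ₐ[R] MvPowerSeries ι R ⧸ K := Ideal.Quotient.mkₐ R K
  have hI : M.map q ^ n = ⊥ := by
    rw [← Ideal.map_pow, ← le_bot_iff, Ideal.map_le_iff_le_comap]
    intro p hp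
    exact Ideal.Quotient.eq_zero_iff_mem.2 (Ideal.mem_sup_right hp)
  have key : ((q.comp e.toAlgHom).comp (map F g)).comp e.symm.toAlgHom = q := by
    refine (MvPowerSeries.algHom_ext_of_nilpotent hI (fun i => ?_) fun i => ?_).symm
    · exact Ideal.mem_map_of_mem _ (Ideal.subset_span ⟨i, rfl⟩)
    · have e1 : e.symm (MvPowerSeries.X i) = x F (b i) := by rw [← h, e.symm_apply_apply]
      have e2 : map F g (x F (b i)) = x F (g (b i)) := by
        rw [x, map_mk, rename_X]
        rfl
      change q _ = q (e (map F g (e.symm _)))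
      rw [e1, e2, ← h i]
      refine (Ideal.Quotient.eq.2 (Ideal.mem_sup_left ?_)).symm
      obtain ⟨m, hm⟩ := hg (b i)
      rw [Ideal.mem_span_singleton, hm, ← h j, ← map_sub, map_dvd_iff]
      exact x_dvd_x_add_zsmul_sub F _ _ m
  have := DFunLike.congr_fun key (e y)
  change q (e (map F g (e.symm (e y)))) = _ at this
  rw [e.symm_apply_apply] at this
  exact Ideal.Quotient.eq.1 this

end FormalGroupAlgebra

end

/-! ### Words, lengths and rank two computations in the Weyl group. -/

noncomputable section

namespace KacMoodyRootDatum

variable {n : ℕ} {A : GeneralizedCartanMatrix n} {𝔥 : Type*} [AddCommGroup 𝔥] [Module ℂ 𝔥]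
  (D : KacMoodyRootDatum A 𝔥)

/-! ### Words and lengths -/

theorem s_apply (i : Fin n) (l : Dual ℂ 𝔥) :
    (D.s i).1 l = l - l (D.coroot i) • D.root i := D.simpleReflection_apply i l

theorem s_apply_root (i j : Fin n) :
    (D.s i).1 (D.root j) = D.root j - (A.entry i j : ℂ) • D.root i := by
  rw [s_apply, D.pairing]

theorem s_apply_root_self (i : Fin n) : (D.s i).1 (D.root i) = -D.root i := by
  rw [s_apply_root, A.diag]
  module

theorem s_mul_s (i : Fin n) : D.s i * D.s i = 1 := by
  refine Subtype.ext (LinearEquiv.ext fun l => ?_)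
  exact Module.involutive_reflection (D.eval_coroot_root i) l

theorem s_mul_s_cancel_left (i : Fin n) (w : D.weylGroup) : D.s i * (D.s i * w) = w := by
  rw [← mul_assoc, s_mul_s, one_mul]

theorem mul_s_mul_s (i : Fin n) (w : D.weylGroup) : w * D.s i * D.s i = w := by
  rw [mul_assoc, s_mul_s, mul_one]

theorem inv_s (i : Fin n) : (D.s i)⁻¹ = D.s i := inv_eq_of_mul_eq_one_left (D.s_mul_s i)

/-- The product `s_{i₁} ⋯ s_{i_k}` of a word. -/
def wordProd (l : List (Fin n)) : D.weylGroup := (l.map D.s).prod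

theorem wordProd_nil : D.wordProd [] = 1 := rfl

theorem wordProd_cons (i : Fin n) (l : List (Fin n)) :
    D.wordProd (i :: l) = D.s i * D.wordProd l := by simp [wordProd]

theorem wordProd_append (l m : List (Fin n)) :
    D.wordProd (l ++ m) = D.wordProd l * D.wordProd m := by simp [wordProd]

theorem wordProd_singleton (i : Fin n) : D.wordProd [i] = D.s i := by simp [wordProd]

theorem wordProd_concat (l : List (Fin n)) (i : Fin n) :
    D.wordProd (l ++ [i]) = D.wordProd l * D.s i := by
  rw [wordProd_append, wordProd_singleton]

theorem exists_wordProd (w : D.weylGroup) : ∃ l, D.wordProd l = w := by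
  obtain ⟨w, hw⟩ := w
  suffices h : ∃ l, (D.wordProd l).1 = w by
    obtain ⟨l, hl⟩ := h
    exact ⟨l, Subtype.ext hl⟩
  induction hw using Subgroup.closure_induction'' with
  | mem x hx => obtain ⟨i, rfl⟩ := hx; exact ⟨[i], by rw [wordProd_singleton]; rfl⟩
  | inv_mem x hx =>
    obtain ⟨i, rfl⟩ := hx
    refine ⟨[i], ?_⟩
    rw [wordProd_singleton, ← inv_s]
    rfl
  | one => exact ⟨[], rfl⟩
  | mul x y _ _ hx hy =>
    obtain ⟨l, rfl⟩ := hx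
    obtain ⟨m, rfl⟩ := hy
    exact ⟨l ++ m, by rw [wordProd_append]; rfl⟩

/-- The length of an element of the Weyl group. -/
def len (w : D.weylGroup) : ℕ := sInf {k | ∃ l, D.wordProd l = w ∧ l.length = k}

theorem exists_reduced (w : D.weylGroup) : ∃ l, D.wordProd l = w ∧ l.length = D.len w := by
  obtain ⟨l, hl⟩ := D.exists_wordProd w
  exact Nat.sInf_mem (s := {k | ∃ l, D.wordProd l = w ∧ l.length = k}) ⟨_, l, hl, rfl⟩

theorem len_le {w : D.weylGroup} {l : List (Fin n)} (h : D.wordProd l = w) : D.len w ≤ l.length :=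
  Nat.sInf_le ⟨l, h, rfl⟩

theorem len_mul_wordProd_le (w : D.weylGroup) (l : List (Fin n)) :
    D.len (w * D.wordProd l) ≤ D.len w + l.length := by
  obtain ⟨m, rfl, h⟩ := D.exists_reduced w
  rw [← h, ← List.length_append]
  exact D.len_le (D.wordProd_append m l)

theorem len_mul_s_le (w : D.weylGroup) (i : Fin n) : D.len (w * D.s i) ≤ D.len w + 1 := by
  simpa [wordProd_singleton] using D.len_mul_wordProd_le w [i]

theorem len_s_mul_le (w : D.weylGroup) (i : Fin n) : D.len (D.s i * w) ≤ D.len w + 1 := by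
  obtain ⟨m, rfl, h⟩ := D.exists_reduced w
  rw [← h]
  exact D.len_le (D.wordProd_cons i m)

theorem exists_len_mul_s_lt {w : D.weylGroup} (hw : w ≠ 1) : ∃ i, D.len (w * D.s i) < D.len w := by
  obtain ⟨l, rfl, h⟩ := D.exists_reduced w
  rcases List.eq_nil_or_concat l with rfl | ⟨m, i, rfl⟩
  · exact absurd D.wordProd_nil hw
  · refine ⟨i, ?_⟩
    rw [← h, List.concat_eq_append, wordProd_concat, mul_s_mul_s]
    simpa using Nat.lt_succ_of_le (D.len_le (l := m) rfl)

/-! ### Positive combinations of simple roots -/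

/-- Nonnegative combinations of simple roots. -/
def IsPos (γ : Dual ℂ 𝔥) : Prop :=
  ∃ c : Fin n → ℝ, (∀ i, 0 ≤ c i) ∧ γ = ∑ i, (c i : ℂ) • D.root i

variable {D}

theorem IsPos.add {γ δ : Dual ℂ 𝔥} (hγ : D.IsPos γ) (hδ : D.IsPos δ) : D.IsPos (γ + δ) := by
  obtain ⟨c, hc, rfl⟩ := hγ
  obtain ⟨d, hd, rfl⟩ := hδ
  refine ⟨c + d, fun i => add_nonneg (hc i) (hd i), ?_⟩
  simp [add_smul, Finset.sum_add_distrib]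

theorem IsPos.smul {γ : Dual ℂ 𝔥} (hγ : D.IsPos γ) {r : ℝ} (hr : 0 ≤ r) :
    D.IsPos ((r : ℂ) • γ) := by
  obtain ⟨c, hc, rfl⟩ := hγ
  refine ⟨fun i => r * c i, fun i => mul_nonneg hr (hc i), ?_⟩
  simp [Finset.smul_sum, mul_smul]

variable (D)

theorem isPos_root (i : Fin n) : D.IsPos (D.root i) := by
  refine ⟨Pi.single i 1, fun j => ?_, ?_⟩
  · by_cases h : j = i
    · subst h; simp
    · simp [h]
  · rw [Finset.sum_eq_single i] <;> simp +contextual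

theorem coeff_ext {c d : Fin n → ℂ} (h : ∑ i, c i • D.root i = ∑ i, d i • D.root i) : c = d := by
  have := Fintype.linearIndependent_iff.1 D.root_indep (c - d) (by
    simp only [Pi.sub_apply, sub_smul, Finset.sum_sub_distrib, h, sub_self])
  ext i
  exact sub_eq_zero.1 (this i)

theorem smul_root_eq_sum (i : Fin n) (z : ℂ) :
    z • D.root i = ∑ k, (Pi.single i z : Fin n → ℂ) k • D.root k := by
  rw [Finset.sum_eq_single i] <;> simp +contextual

variable {D}

theorem IsPos.eq_zero {γ : Dual ℂ 𝔥} (h : D.IsPos γ) (h' : D.IsPos (-γ)) : γ = 0 := by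
  obtain ⟨c, hc, rfl⟩ := h
  obtain ⟨d, hd, h⟩ := h'
  have e := D.coeff_ext (c := fun i => -(c i : ℂ)) (d := fun i => d i) (by
    rw [← h, ← Finset.sum_neg_distrib]
    simp)
  refine Finset.sum_eq_zero fun i _ => ?_
  have h1 : -c i = d i := by exact_mod_cast congrFun e i
  have h2 : c i = 0 := by linarith [hc i, hd i]
  simp [h2]

/-! ### Rank two -/

variable (D)

/-- The alternating word of length `k` in `i` and `j` which ends in `i`. -/
def altWord (i j : Fin n) : ℕ → List (Fin n)
  | 0 => []
  | k + 1 => altWord j i k ++ [i]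

theorem length_altWord (i j : Fin n) (k : ℕ) : (altWord i j k).length = k := by
  induction k generalizing i j with
  | zero => rfl
  | succ k ih => simp [altWord, ih]

theorem altWord_add (i j : Fin n) (k m : ℕ) :
    ∃ l : List (Fin n), l.length = k ∧ altWord i j (k + m) = l ++ altWord i j m := by
  induction m generalizing i j with
  | zero => exact ⟨altWord i j k, length_altWord i j k, by simp [altWord]⟩
  | succ m ih =>
    obtain ⟨l, hl, h⟩ := ih j i
    exact ⟨l, hl, by rw [← add_assoc, altWord, altWord, h, List.append_assoc]⟩

theorem wordProd_altWord_succ (i j : Fin n) (k : ℕ) :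
    D.wordProd (altWord i j (k + 1)) = D.wordProd (altWord j i k) * D.s i :=
  D.wordProd_concat _ _

theorem wordProd_altWord_succ_mul (i j : Fin n) (k : ℕ) :
    D.wordProd (altWord i j (k + 1)) * D.s i = D.wordProd (altWord j i k) := by
  rw [wordProd_altWord_succ, mul_s_mul_s]

/-- The roots `(⋯ s_i s_j)(α_i)`. -/
def altRoot (i j : Fin n) (k : ℕ) : Dual ℂ 𝔥 := (D.wordProd (altWord j i k)).1 (D.root i)

theorem altRoot_zero (i j : Fin n) : D.altRoot i j 0 = D.root i := rfl

theorem altRoot_one (i j : Fin n) :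
    D.altRoot i j 1 = D.root i - (A.entry j i : ℂ) • D.root j := by
  rw [altRoot, wordProd_altWord_succ, ← s_apply_root]
  rfl

theorem altRoot_add_two (i j : Fin n) (k : ℕ) : D.altRoot i j (k + 2) =
    -D.altRoot i j k - (A.entry j i : ℂ) • D.altRoot j i (k + 1) := by
  rw [altRoot, wordProd_altWord_succ, Subgroup.coe_mul, LinearEquiv.mul_apply, s_apply_root,
    map_sub, map_smul]
  congr 1
  rw [wordProd_altWord_succ, Subgroup.coe_mul, LinearEquiv.mul_apply, s_apply_root_self, map_neg]
  rfl

variable {D} in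
-- The induction closes once b Q_{k+1} − 2 P_k and a P_{k+1} − 2 Q_k are carried along: P_{k+2} is
-- the first of them plus P_k, and b Q_{k+2} − 2 P_{k+1} = (b/2)(a P_{k+1} − 2 Q_k) + (ab/2 − 2)
-- P_{k+1}, whose last coefficient requires ab ≥ 4.
theorem isPos_of_recursion {P Q : ℕ → Dual ℂ 𝔥} {a b : ℝ} (ha : 0 ≤ a) (hb : 0 ≤ b)
    (hab : 4 ≤ a * b) (hP0 : D.IsPos (P 0)) (hQ0 : D.IsPos (Q 0))
    (hP1 : P 1 = P 0 + (b : ℂ) • Q 0) (hQ1 : Q 1 = Q 0 + (a : ℂ) • P 0)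
    (hP : ∀ k, P (k + 2) = -P k + (b : ℂ) • Q (k + 1))
    (hQ : ∀ k, Q (k + 2) = -Q k + (a : ℂ) • P (k + 1)) (k : ℕ) : D.IsPos (P k) := by
  have key : ∀ k, (D.IsPos (P k) ∧ D.IsPos (Q k)) ∧ (D.IsPos (P (k + 1)) ∧ D.IsPos (Q (k + 1))) ∧
      D.IsPos ((b : ℂ) • Q (k + 1) - (2 : ℂ) • P k) ∧
      D.IsPos ((a : ℂ) • P (k + 1) - (2 : ℂ) • Q k) := by
    intro k
    induction k with
    | zero =>
      refine ⟨⟨hP0, hQ0⟩, ⟨hP1 ▸ hP0.add (hQ0.smul hb), hQ1 ▸ hQ0.add (hP0.smul ha)⟩, ?_, ?_⟩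
      · have := (hQ0.smul hb).add (hP0.smul (show 0 ≤ a * b - 2 by linarith))
        convert! this using 1
        rw [zero_add, hQ1]
        push_cast
        module
      · have := (hP0.smul ha).add (hQ0.smul (show 0 ≤ a * b - 2 by linarith))
        convert! this using 1
        rw [zero_add, hP1]
        push_cast
        module
    | succ k ih =>
      obtain ⟨⟨h1, h2⟩, ⟨h3, h4⟩, h5, h6⟩ := ih
      refine ⟨⟨h3, h4⟩, ⟨?_, ?_⟩, ?_, ?_⟩
      · convert! h5.add h1 using 1
        rw [hP]
        module
      · convert! h6.add h2 using 1
        rw [hQ]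
        module
      · convert! (h6.smul (show 0 ≤ b / 2 by linarith)).add
          (h3.smul (show 0 ≤ a * b / 2 - 2 by linarith)) using 1
        rw [hQ]
        push_cast
        module
      · convert! (h5.smul (show 0 ≤ a / 2 by linarith)).add
          (h4.smul (show 0 ≤ a * b / 2 - 2 by linarith)) using 1
        rw [hP]
        push_cast
        module
  exact (key k).1.1

theorem entry_cast_nonneg {i j : Fin n} (hij : i ≠ j) : 0 ≤ -(A.entry i j : ℝ) := by
  have := A.off_diag i j hij
  rw [neg_nonneg]
  exact_mod_cast this

theorem isPos_altRoot_of_four_le {i j : Fin n} (hij : i ≠ j) (h : 4 ≤ A.entry i j * A.entry j i)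
    (k : ℕ) : D.IsPos (D.altRoot i j k) := by
  refine isPos_of_recursion (P := D.altRoot i j) (Q := D.altRoot j i)
    (entry_cast_nonneg (A := A) hij) (entry_cast_nonneg (A := A) hij.symm)
    ?_ (D.isPos_root i) (D.isPos_root j) ?_ ?_ (fun k => ?_) (fun k => ?_) k
  · rw [neg_mul_neg]
    exact_mod_cast h
  · rw [altRoot_one, altRoot_zero, altRoot_zero]
    push_cast
    module
  · rw [altRoot_one, altRoot_zero, altRoot_zero]
    push_cast
    module
  · rw [altRoot_add_two]
    push_cast
    module
  · rw [altRoot_add_two]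
    push_cast
    module

theorem s_apply_add {i j : Fin n} (l : Dual ℂ 𝔥) (y z : ℂ) :
    (D.s i).1 (l + y • D.root i + z • D.root j) =
      l + (-y - l (D.coroot i) - z * A.entry i j) • D.root i + z • D.root j := by
  simp only [s_apply, LinearMap.add_apply, LinearMap.smul_apply, D.pairing, A.diag, smul_eq_mul]
  push_cast
  module

theorem s_apply_add' {i j : Fin n} (l : Dual ℂ 𝔥) (y z : ℂ) :
    (D.s j).1 (l + y • D.root i + z • D.root j) =
      l + y • D.root i + (-z - l (D.coroot j) - y * A.entry j i) • D.root j := by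
  simp only [s_apply, LinearMap.add_apply, LinearMap.smul_apply, D.pairing, A.diag, smul_eq_mul]
  push_cast
  module

theorem cartan_cases {i j : Fin n} (hij : i ≠ j) (h : A.entry i j * A.entry j i < 4) :
    (A.entry i j = 0 ∧ A.entry j i = 0) ∨ (A.entry i j = -1 ∧ A.entry j i = -1) ∨
    (A.entry i j = -1 ∧ A.entry j i = -2) ∨ (A.entry i j = -2 ∧ A.entry j i = -1) ∨
    (A.entry i j = -1 ∧ A.entry j i = -3) ∨ (A.entry i j = -3 ∧ A.entry j i = -1) := by
  have h1 := A.off_diag i j hij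
  have h2 := A.off_diag j i hij.symm
  have h3 := A.zero_iff i j
  obtain ⟨a, ha⟩ : ∃ a, A.entry i j = a := ⟨_, rfl⟩
  obtain ⟨b, hb⟩ : ∃ b, A.entry j i = b := ⟨_, rfl⟩
  rw [ha, hb] at h h3 ⊢
  rw [ha] at h1
  rw [hb] at h2
  rcases eq_or_lt_of_le h1 with rfl | h1'
  · exact Or.inl ⟨rfl, h3.1 rfl⟩
  have h2' : b < 0 := lt_of_le_of_ne h2 fun e => h1'.ne (h3.2 e)
  have h4 : -4 < a := by nlinarith
  have h5 : -4 < b := by nlinarith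
  interval_cases a <;> interval_cases b <;> simp_all

/-- The coefficients of `altRoot i j k` at `α_i` and `α_j`, in terms of `p = a_ij`, `q = a_ji`. -/
def altCoeff : ℤ → ℤ → ℕ → ℤ × ℤ
  | _, _, 0 => (1, 0)
  | _, q, 1 => (1, -q)
  | p, q, k + 2 => (-(altCoeff p q k).1 - q * (altCoeff q p (k + 1)).2,
      -(altCoeff p q k).2 - q * (altCoeff q p (k + 1)).1)

theorem altRoot_eq (i j : Fin n) (k : ℕ) : D.altRoot i j k =
    ((altCoeff (A.entry i j) (A.entry j i) k).1 : ℂ) • D.root i +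
      ((altCoeff (A.entry i j) (A.entry j i) k).2 : ℂ) • D.root j := by
  induction k using Nat.strong_induction_on generalizing i j with
  | h k ih =>
    match k with
    | 0 => simp [altRoot_zero, altCoeff]
    | 1 =>
      rw [altRoot_one, altCoeff]
      push_cast
      module
    | k + 2 =>
      rw [altRoot_add_two, ih k (by omega), ih (k + 1) (by omega), altCoeff]
      push_cast
      module

/-- Only finitely many Cartan pairs have product below 4. They give s_i s_j order m + 1 = 2, 3, 4 or
6, and the signs of the coefficients are a finite check. -/
theorem exists_braid {i j : Fin n} (hij : i ≠ j) (h : A.entry i j * A.entry j i < 4) :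
    ∃ m, D.wordProd (altWord i j (m + 1)) = D.wordProd (altWord j i (m + 1)) ∧
      ∀ k ≤ m, 0 ≤ (altCoeff (A.entry i j) (A.entry j i) k).1 ∧
        0 ≤ (altCoeff (A.entry i j) (A.entry j i) k).2 := by
  -- The roots need not span 𝔥*, so the relation is checked on an arbitrary functional l. The zero
  -- terms put l into the shape that `s_apply_add` and `s_apply_add'` preserve.
  have key : ∀ m, (∀ l : Dual ℂ 𝔥,
      (D.wordProd (altWord i j (m + 1))).1 (l + (0 : ℂ) • D.root i + (0 : ℂ) • D.root j) =
      (D.wordProd (altWord j i (m + 1))).1 (l + (0 : ℂ) • D.root i + (0 : ℂ) • D.root j)) →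
      D.wordProd (altWord i j (m + 1)) = D.wordProd (altWord j i (m + 1)) := by
    intro m hm
    refine Subtype.ext (LinearEquiv.ext fun l => ?_)
    simpa using hm l
  rcases cartan_cases (A := A) hij h with h | h | h | h | h | h <;> obtain ⟨h1, h2⟩ := h <;>
  rw [h1, h2] <;> [use 1; use 2; use 3; use 3; use 5; use 5] <;>
  refine ⟨key _ fun l => ?_, by decide⟩ <;>
  · simp only [altWord, List.nil_append, wordProd_append, wordProd_singleton, Subgroup.coe_mul,
      LinearEquiv.mul_apply, s_apply_add, s_apply_add', h1, h2]
    push_cast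
    ring_nf

/-- A letter repeated in succession would cancel and give a shorter word with the same product. -/
theorem exists_eq_altWord {i j : Fin n} {u : List (Fin n)} (hu : ∀ c ∈ u, c = i ∨ c = j)
    (h : ∀ l, D.wordProd l = D.wordProd u → u.length ≤ l.length) :
    D.wordProd u = D.wordProd (altWord i j u.length) ∨
      D.wordProd u = D.wordProd (altWord j i u.length) := by
  induction u using List.reverseRecOn with
  | nil => exact Or.inl rfl
  | append_singleton u c ih =>
    have h' : ∀ l, D.wordProd l = D.wordProd u → u.length ≤ l.length := by
      intro l hl
      have := h (l ++ [c]) (by rw [wordProd_concat, wordProd_concat, hl])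
      simpa using this
    have step : ∀ a b, D.wordProd u = D.wordProd (altWord a b u.length) →
        D.wordProd (u ++ [a]) = D.wordProd (altWord a b (u.length + 1)) ∨ c ≠ a := by
      intro a b hab
      by_contra! hc
      obtain ⟨hc, rfl⟩ := hc
      rcases hk : u.length with _ | k
      · rw [hk] at hab hc
        apply hc
        rw [wordProd_concat, hab, wordProd_altWord_succ]
        rfl
      · rw [hk, wordProd_altWord_succ] at hab
        have := h (altWord b c k) (by rw [wordProd_concat, hab, mul_s_mul_s])
        simp [length_altWord, hk] at this
    have step' : ∀ a b, D.wordProd u = D.wordProd (altWord a b u.length) →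
        D.wordProd (u ++ [b]) = D.wordProd (altWord b a (u.length + 1)) := by
      intro a b hab
      rw [wordProd_concat, hab, wordProd_altWord_succ]
    rw [List.length_append, List.length_singleton]
    have hc : c = i ∨ c = j := hu c (by simp)
    rcases ih (fun c hc => hu c (by simp [hc])) h' with h1 | h1
    · rcases hc with rfl | rfl
      · exact Or.inl ((step _ _ h1).resolve_right (by simp))
      · exact Or.inr (step' _ _ h1)
    · rcases hc with rfl | rfl
      · exact Or.inl (step' _ _ h1)
      · exact Or.inr ((step _ _ h1).resolve_right (by simp))

end KacMoodyRootDatum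

end

/-! ### Positivity of real roots, reflections and the exchange condition. -/

noncomputable section

namespace KacMoodyRootDatum

variable {n : ℕ} {A : GeneralizedCartanMatrix n} {𝔥 : Type*} [AddCommGroup 𝔥] [Module ℂ 𝔥]
  (D : KacMoodyRootDatum A 𝔥)

/-- The case of rank two of the positivity of roots. -/
theorem isPos_mul_of_reduced {i j : Fin n} (hij : i ≠ j) {u : List (Fin n)}
    (hu : ∀ c ∈ u, c = i ∨ c = j) (h : ∀ l, D.wordProd l = D.wordProd u → u.length ≤ l.length)
    (h' : ∀ l, D.wordProd l = D.wordProd u * D.s i → u.length ≤ l.length) {w : D.weylGroup}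
    (hi : D.IsPos (w.1 (D.root i))) (hj : D.IsPos (w.1 (D.root j))) :
    D.IsPos ((w * D.wordProd u).1 (D.root i)) := by
  obtain ⟨k, hk⟩ : ∃ k, u.length = k := ⟨_, rfl⟩
  have hu' : D.wordProd u = D.wordProd (altWord j i k) := by
    rcases D.exists_eq_altWord hu h with h1 | h1
    · rw [hk] at h1
      cases k with
      | zero => exact h1
      | succ k =>
        have := h' (altWord j i k) (by rw [h1, wordProd_altWord_succ_mul])
        rw [hk, length_altWord] at this
        omega
    · rw [hk] at h1
      exact h1
  have e : (w * D.wordProd u).1 (D.root i) = w.1 (D.altRoot i j k) := by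
    rw [hu']
    rfl
  have hnn : 0 ≤ (altCoeff (A.entry i j) (A.entry j i) k).1 ∧
      0 ≤ (altCoeff (A.entry i j) (A.entry j i) k).2 := by
    rcases lt_or_ge (A.entry i j * A.entry j i) 4 with hlt | hge
    · obtain ⟨m, hm, hnn⟩ := D.exists_braid hij hlt
      refine hnn k (not_lt.1 fun hmk => ?_)
      -- For k > m the braid relation would make the word end in i; cancelling that letter against
      -- s_i leaves a word of length k − 1, contradicting `h'`.
      obtain ⟨l, hl, e⟩ := altWord_add j i (k - (m + 1)) (m + 1)
      rw [Nat.sub_add_cancel hmk] at e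
      have := h' (l ++ altWord j i m) (by
        rw [hu', e, wordProd_append, wordProd_append, ← hm, mul_assoc, wordProd_altWord_succ_mul])
      rw [List.length_append, length_altWord, hl, hk] at this
      omega
    · have h1 := D.isPos_altRoot_of_four_le hij hge k
      obtain ⟨c, hc, h2⟩ := h1
      rw [altRoot_eq, smul_root_eq_sum, smul_root_eq_sum, ← Finset.sum_add_distrib] at h2
      simp only [← add_smul] at h2
      have h3 := D.coeff_ext h2
      have hci := congrFun h3 i
      have hcj := congrFun h3 j
      simp only [Pi.single_eq_same, Pi.single_eq_of_ne hij, Pi.single_eq_of_ne hij.symm, add_zero,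
        zero_add] at hci hcj
      have hci' : ((altCoeff (A.entry i j) (A.entry j i) k).1 : ℝ) = c i := by exact_mod_cast hci
      have hcj' : ((altCoeff (A.entry i j) (A.entry j i) k).2 : ℝ) = c j := by exact_mod_cast hcj
      have ci := hc i
      have cj := hc j
      rw [← hci'] at ci
      rw [← hcj'] at cj
      exact ⟨by exact_mod_cast ci, by exact_mod_cast cj⟩
  rw [e, altRoot_eq, map_add, map_smul, map_smul]
  have h1 := hi.smul (r := ((altCoeff (A.entry i j) (A.entry j i) k).1 : ℝ))
    (by exact_mod_cast hnn.1)
  have h2 := hj.smul (r := ((altCoeff (A.entry i j) (A.entry j i) k).2 : ℝ))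
    (by exact_mod_cast hnn.2)
  exact_mod_cast h1.add h2

/-- Choose j with w s_j shorter than w, and write w = v u with u a word in i and j, lengths adding
up, and v as short as possible. Minimality makes v s_i and v s_j no shorter than v, so v(α_i) and
v(α_j) are positive by induction, and the rank two case applies to u. -/
theorem isPos_of_len_le {w : D.weylGroup} {i : Fin n} (h : D.len w ≤ D.len (w * D.s i)) :
    D.IsPos (w.1 (D.root i)) := by
  obtain ⟨N, hN⟩ : ∃ N, D.len w = N := ⟨_, rfl⟩
  induction N using Nat.strong_induction_on generalizing w i with
  | h N ih =>
  by_cases hw : w = 1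
  · subst hw
    exact D.isPos_root i
  obtain ⟨j, hj⟩ := D.exists_len_mul_s_lt hw
  have hij : i ≠ j := by
    rintro rfl
    omega
  let P : ℕ → Prop := fun k => ∃ (v : D.weylGroup) (u : List (Fin n)), D.len v = k ∧
    (∀ c ∈ u, c = i ∨ c = j) ∧ w = v * D.wordProd u ∧ D.len v + u.length = D.len w
  have hstart : P (D.len (w * D.s j)) := by
    refine ⟨w * D.s j, [j], rfl, by simp, ?_, ?_⟩
    · rw [wordProd_singleton, mul_s_mul_s]
    · have := D.len_mul_s_le (w * D.s j) j
      rw [mul_s_mul_s] at this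
      simp only [List.length_singleton]
      omega
  classical
  have hP : ∃ k, P k := ⟨_, hstart⟩
  obtain ⟨v, u, hv, hu, rfl, hlen⟩ := Nat.find_spec hP
  have hvlt : D.len v < N := by
    rw [hv, ← hN]
    exact lt_of_le_of_lt (Nat.find_min' hP hstart) hj
  have hmin : ∀ c, (c = i ∨ c = j) → D.len v ≤ D.len (v * D.s c) := by
    intro c hc
    by_contra! hlt
    have h1 : D.wordProd (c :: u) = D.s c * D.wordProd u := D.wordProd_cons c u
    have h2 : v * D.wordProd u = v * D.s c * D.wordProd (c :: u) := by
      rw [h1, mul_assoc, s_mul_s_cancel_left]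
    have h3 := D.len_mul_wordProd_le (v * D.s c) (c :: u)
    rw [← h2, List.length_cons] at h3
    refine Nat.find_min hP (m := D.len (v * D.s c)) (hv ▸ hlt)
      ⟨v * D.s c, c :: u, rfl, ?_, h2, ?_⟩
    · simpa using ⟨hc, hu⟩
    · rw [List.length_cons]
      omega
  refine D.isPos_mul_of_reduced hij hu (fun l hl => ?_) (fun l hl => ?_)
    (ih _ hvlt (hmin i (Or.inl rfl)) rfl) (ih _ hvlt (hmin j (Or.inr rfl)) rfl)
  · have := D.len_mul_wordProd_le v l
    rw [hl] at this
    omega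
  · have := D.len_mul_wordProd_le v l
    rw [hl, ← mul_assoc] at this
    omega

theorem isPos_or_neg (w : D.weylGroup) (i : Fin n) :
    D.IsPos (w.1 (D.root i)) ∨ D.IsPos (-w.1 (D.root i)) := by
  rcases le_total (D.len w) (D.len (w * D.s i)) with h | h
  · exact Or.inl (D.isPos_of_len_le h)
  · refine Or.inr ?_
    have := D.isPos_of_len_le (w := w * D.s i) (i := i) (by rwa [mul_s_mul_s])
    rwa [Subgroup.coe_mul, LinearEquiv.mul_apply, s_apply_root_self, map_neg] at this

theorem root_ne_zero (w : D.weylGroup) (i : Fin n) : w.1 (D.root i) ≠ 0 := fun h =>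
  D.root_indep.ne_zero i ((LinearEquiv.map_eq_zero_iff _).1 h)

theorem eq_one_of_isPos {w : D.weylGroup} (h : ∀ i, D.IsPos (w.1 (D.root i))) : w = 1 := by
  by_contra hw
  obtain ⟨i, hi⟩ := D.exists_len_mul_s_lt hw
  have := D.isPos_of_len_le (w := w * D.s i) (i := i) (by rw [mul_s_mul_s]; exact hi.le)
  rw [Subgroup.coe_mul, LinearEquiv.mul_apply, s_apply_root_self, map_neg] at this
  exact D.root_ne_zero w i ((h i).eq_zero this)

/-- For k ≠ i the root w(α_k) has coefficient 1 at α_k, so it is not negative; an element keeping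
all simple roots positive is trivial. This recognizes elements of W by their action on roots,
although roots need not span 𝔥*. -/
theorem eq_one_of_fixed {w : D.weylGroup} {i : Fin n} (hi : w.1 (D.root i) = D.root i)
    (h : ∀ k, ∃ z : ℂ, w.1 (D.root k) = D.root k + z • D.root i) : w = 1 := by
  refine D.eq_one_of_isPos fun k => ?_
  by_cases hk : k = i
  · rw [hk, hi]
    exact D.isPos_root i
  refine (D.isPos_or_neg w k).resolve_right fun hneg => ?_
  obtain ⟨z, hz⟩ := h k
  obtain ⟨c, hc, e⟩ := hneg
  have e' : (-1 : ℂ) • D.root k + (-z) • D.root i = ∑ i, (c i : ℂ) • D.root i := by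
    rw [← e, hz]
    module
  rw [smul_root_eq_sum, smul_root_eq_sum, ← Finset.sum_add_distrib] at e'
  simp only [← add_smul] at e'
  have := congrFun (D.coeff_ext e') k
  simp only [Pi.single_eq_same, Pi.single_eq_of_ne hk, add_zero] at this
  have h1 : (-1 : ℝ) = c k := by exact_mod_cast this
  linarith [hc k]

/-! ### Real roots -/

theorem exists_int_coeff (w : D.weylGroup) (i : Fin n) :
    ∃ c : Fin n → ℤ, w.1 (D.root i) = ∑ k, (c k : ℂ) • D.root k := by
  obtain ⟨l, rfl⟩ := D.exists_wordProd w
  induction l with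
  | nil =>
    refine ⟨Pi.single i 1, ?_⟩
    rw [Finset.sum_eq_single i] <;> simp +contextual [wordProd_nil]
  | cons j l ih =>
    obtain ⟨c, hc⟩ := ih
    refine ⟨c - Pi.single j (∑ k, c k * A.entry j k), ?_⟩
    rw [wordProd_cons, Subgroup.coe_mul, LinearEquiv.mul_apply, hc, s_apply]
    have e : ∀ k, (((Pi.single j (∑ k, c k * A.entry j k) : Fin n → ℤ) k : ℤ) : ℂ) =
        (Pi.single j (∑ k, (c k : ℂ) * A.entry j k) : Fin n → ℂ) k := by
      intro k
      by_cases hk : k = j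
      · subst hk
        simp
      · simp [hk]
    simp only [Pi.sub_apply, Int.cast_sub, sub_smul, Finset.sum_sub_distrib, e,
      ← smul_root_eq_sum]
    simp [D.pairing]

/-- Roots have integer coordinates; applied to w and w⁻¹, this makes c an integer with an integer
inverse. -/
theorem eq_one_or_neg_one_of_smul {w : D.weylGroup} {i j : Fin n} {c : ℂ}
    (h : w.1 (D.root i) = c • D.root j) : c = 1 ∨ c = -1 := by
  obtain ⟨d, hd⟩ := D.exists_int_coeff w i
  obtain ⟨d', hd'⟩ := D.exists_int_coeff w⁻¹ j
  have h1 : c = d j := by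
    rw [h, smul_root_eq_sum] at hd
    simpa using congrFun (D.coeff_ext hd) j
  have h2 : D.root i = c • (w⁻¹).1 (D.root j) := by
    rw [← map_smul, ← h, ← LinearEquiv.mul_apply, ← Subgroup.coe_mul, inv_mul_cancel]
    rfl
  have h3 : (1 : ℂ) = c * d' i := by
    rw [hd', Finset.smul_sum, ← one_smul ℂ (D.root i), smul_root_eq_sum] at h2
    simp only [smul_smul] at h2
    simpa using congrFun (D.coeff_ext h2) i
  rw [h1] at h3 ⊢
  have h4 : 1 = d j * d' i := by exact_mod_cast h3
  rcases Int.isUnit_iff.1 (IsUnit.of_mul_eq_one _ h4.symm) with h5 | h5 <;> simp [h5]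

theorem rootReflection_apply_self (w : D.weylGroup) (i : Fin n) :
    (D.rootReflection w i).1 (w.1 (D.root i)) = -w.1 (D.root i) := by
  rw [rootReflection, ← LinearEquiv.mul_apply, ← Subgroup.coe_mul, inv_mul_cancel_right,
    Subgroup.coe_mul, LinearEquiv.mul_apply, s_apply_root_self, map_neg]

theorem rootReflection_mul_self (w : D.weylGroup) (i : Fin n) :
    D.rootReflection w i * D.rootReflection w i = 1 := by
  rw [rootReflection, show w * D.s i * w⁻¹ * (w * D.s i * w⁻¹) = w * (D.s i * D.s i) * w⁻¹ by group,
    s_mul_s, mul_one, mul_inv_cancel]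

/-- The reflection is defined from the pair (w, i) rather than from the root. Its product with s_j
fixes α_j and moves each simple root by a multiple of α_j, so it is trivial. -/
theorem rootReflection_eq_s {w : D.weylGroup} {i j : Fin n} (h : w.1 (D.root i) = D.root j) :
    D.rootReflection w i = D.s j := by
  suffices D.s j * D.rootReflection w i = 1 by
    rw [← D.inv_s]
    exact (inv_eq_of_mul_eq_one_right this).symm
  refine D.eq_one_of_fixed (i := j) ?_ fun k => ?_
  · rw [Subgroup.coe_mul, LinearEquiv.mul_apply]
    have := D.rootReflection_apply_self w i
    rw [h] at this
    rw [this, map_neg, s_apply_root_self, neg_neg]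
  · rw [Subgroup.coe_mul, LinearEquiv.mul_apply, rootReflection_apply, h, map_sub, map_smul,
      s_apply_root_self, s_apply_root]
    refine ⟨(w⁻¹.1 (D.root k)) (D.coroot i) - A.entry j k, ?_⟩
    module

theorem rootReflection_mul_s (w : D.weylGroup) (i : Fin n) :
    D.rootReflection (w * D.s i) i = D.rootReflection w i := by
  rw [rootReflection, mul_s_mul_s, mul_inv_rev, inv_s, ← mul_assoc, rootReflection]

theorem rootReflection_mul (v w : D.weylGroup) (i : Fin n) :
    D.rootReflection (v * w) i = v * D.rootReflection w i * v⁻¹ := by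
  rw [rootReflection, rootReflection]
  group

/-- A positive real root which becomes negative under `s_j` is `α_j`. -/
theorem eq_root_of_isPos_neg {w : D.weylGroup} {i j : Fin n} (h : D.IsPos (w.1 (D.root i)))
    (h' : D.IsPos (-(D.s j).1 (w.1 (D.root i)))) : w.1 (D.root i) = D.root j := by
  obtain ⟨c, hc, e⟩ := h
  obtain ⟨d, hd, e'⟩ := h'
  have e1 : ∑ k, ((c k : ℂ) + d k) • D.root k =
      ((w.1 (D.root i)) (D.coroot j)) • D.root j := by
    simp only [add_smul, Finset.sum_add_distrib]
    rw [← e, ← e', s_apply]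
    abel
  rw [smul_root_eq_sum] at e1
  have e2 := D.coeff_ext e1
  have e3 : ∀ k, k ≠ j → c k = 0 := by
    intro k hk
    have := congrFun e2 k
    simp only [Pi.single_eq_of_ne hk] at this
    have h1 : c k + d k = 0 := by exact_mod_cast this
    linarith [hc k, hd k]
  have e4 : w.1 (D.root i) = (c j : ℂ) • D.root j := by
    rw [e, Finset.sum_eq_single j]
    · intro k _ hk
      simp [e3 k hk]
    · simp
  rcases D.eq_one_or_neg_one_of_smul e4 with h1 | h1
  · rw [e4, h1, one_smul]
  · have h2 : c j = -1 := by exact_mod_cast h1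
    linarith [hc j]

/-- An element of the Weyl group which moves the real roots by multiples of the real root `α` is
trivial or the reflection `s_α`. -/
theorem eq_one_or_eq_rootReflection {u v : D.weylGroup} {i : Fin n}
    (h : ∀ k, ∃ m : ℤ, u.1 (v.1 (D.root k)) - v.1 (D.root k) = m • v.1 (D.root i)) :
    u = 1 ∨ u = D.rootReflection v i := by
  -- Conjugation by v reduces to the simple root α_i, which is then sent to ±α_i. In the negative
  -- case multiplication by s_i restores the hypotheses of `eq_one_of_fixed`.
  have h' : ∀ k, ∃ z : ℂ, (v⁻¹ * u * v).1 (D.root k) = D.root k + z • D.root i := by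
    intro k
    obtain ⟨m, hm⟩ := h k
    refine ⟨m, ?_⟩
    rw [sub_eq_iff_eq_add] at hm
    have hv : ∀ γ, (v⁻¹).1 (v.1 γ) = γ := fun γ => by
      rw [← LinearEquiv.mul_apply, ← Subgroup.coe_mul, inv_mul_cancel]
      rfl
    rw [Subgroup.coe_mul, LinearEquiv.mul_apply, Subgroup.coe_mul, LinearEquiv.mul_apply, hm,
      map_add, map_zsmul, hv, hv, add_comm, Int.cast_smul_eq_zsmul]
  obtain ⟨z, hz⟩ := h' i
  have hz' : (v⁻¹ * u * v).1 (D.root i) = (1 + z) • D.root i := by rw [hz]; module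
  rcases D.eq_one_or_neg_one_of_smul hz' with h1 | h1
  · left
    rw [h1, one_smul] at hz'
    have := D.eq_one_of_fixed hz' h'
    rw [mul_assoc, inv_mul_eq_one] at this
    exact mul_eq_right.1 this.symm
  · right
    rw [h1, neg_one_smul] at hz'
    have := D.eq_one_of_fixed (w := v⁻¹ * u * v * D.s i) (i := i) ?_ fun k => ?_
    · have e : v⁻¹ * u * v = D.s i := by
        rw [← D.mul_s_mul_s i (v⁻¹ * u * v), this, one_mul]
      rw [rootReflection, ← e]
      group
    · rw [Subgroup.coe_mul, LinearEquiv.mul_apply, s_apply_root_self, map_neg, hz', neg_neg]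
    · obtain ⟨y, hy⟩ := h' k
      refine ⟨y + A.entry i k, ?_⟩
      rw [Subgroup.coe_mul, LinearEquiv.mul_apply, s_apply_root, map_sub, map_smul, hz', hy]
      module

theorem inv_cons_apply (j : Fin n) (l : List (Fin n)) (γ : Dual ℂ 𝔥) :
    ((D.wordProd (j :: l))⁻¹).1 γ = ((D.wordProd l)⁻¹).1 ((D.s j).1 γ) := by
  rw [wordProd_cons, mul_inv_rev, inv_s]
  rfl

/-- The exchange condition: apply the letters to the root from the left. At the letter j where it
first turns negative it equals α_j, and deleting that letter is left multiplication by the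
reflection. -/
theorem exists_wordProd_eq_rootReflection_mul {v : D.weylGroup} {i : Fin n} {l : List (Fin n)}
    (h : D.IsPos (v.1 (D.root i))) (h' : D.IsPos (-((D.wordProd l)⁻¹).1 (v.1 (D.root i)))) :
    ∃ l', l'.length + 1 = l.length ∧ D.wordProd l' = D.rootReflection v i * D.wordProd l := by
  induction l generalizing v with
  | nil =>
    rw [wordProd_nil, inv_one] at h'
    exact absurd (h.eq_zero h') (D.root_ne_zero v i)
  | cons j l ih =>
    rw [inv_cons_apply] at h'
    rcases D.isPos_or_neg (D.s j * v) i with h1 | h1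
    · obtain ⟨l', hl, e⟩ := ih h1 h'
      refine ⟨j :: l', by simp [hl], ?_⟩
      rw [wordProd_cons, e, wordProd_cons, rootReflection_mul, inv_s, mul_assoc,
        ← mul_assoc (D.s j),
        ← mul_assoc (D.s j), s_mul_s, one_mul]
    · have := D.eq_root_of_isPos_neg h h1
      refine ⟨l, rfl, ?_⟩
      rw [D.rootReflection_eq_s this, wordProd_cons, s_mul_s_cancel_left]

/-- The inverse of s_α w sends α to −w⁻¹(α), which is negative, so the exchange condition shortens a
reduced word of s_α w to a word of w. -/
theorem len_lt_of_isPos {v w : D.weylGroup} {i : Fin n} (h : D.IsPos (v.1 (D.root i)))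
    (h' : D.IsPos ((w⁻¹).1 (v.1 (D.root i)))) : D.len w < D.len (D.rootReflection v i * w) := by
  obtain ⟨l, hl, hlen⟩ := D.exists_reduced (D.rootReflection v i * w)
  have hinv : (D.rootReflection v i)⁻¹ = D.rootReflection v i :=
    inv_eq_of_mul_eq_one_left (D.rootReflection_mul_self v i)
  have h1 : D.IsPos (-((D.wordProd l)⁻¹).1 (v.1 (D.root i))) := by
    rw [hl, mul_inv_rev, hinv, Subgroup.coe_mul, LinearEquiv.mul_apply, rootReflection_apply_self,
      map_neg, neg_neg]
    exact h'
  obtain ⟨l', hl', e⟩ := D.exists_wordProd_eq_rootReflection_mul h h1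
  rw [hl, ← mul_assoc, rootReflection_mul_self, one_mul] at e
  have := D.len_le e
  omega

end KacMoodyRootDatum

end

/-! ### The action of the twisted group algebra and regularity at a root. -/

noncomputable section

namespace DemazureLattice

open FormalGroupAlgebra (x smul_x)

section lattice

variable {n : ℕ} {A : GeneralizedCartanMatrix n} {𝔥 : Type*} [AddCommGroup 𝔥] [Module ℂ 𝔥]
  {D : KacMoodyRootDatum A 𝔥} (L : DemazureLattice D)

theorem coe_smul (w : D.weylGroup) (l : L.carrier) :
    ((w • l : L.carrier) : Dual ℂ 𝔥) = w.1 (l : Dual ℂ 𝔥) := rfl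

theorem coe_rootElt (w : D.weylGroup) (i : Fin n) :
    (L.rootElt w i : Dual ℂ 𝔥) = w.1 (D.root i) := rfl

theorem smul_rootElt (v w : D.weylGroup) (i : Fin n) :
    v • L.rootElt w i = L.rootElt (v * w) i := rfl

theorem rootElt_mul_s (v : D.weylGroup) (i : Fin n) :
    L.rootElt (v * D.s i) i = -L.rootElt v i := by
  refine Subtype.ext ?_
  rw [coe_rootElt, Subgroup.coe_mul, LinearEquiv.mul_apply, D.s_apply_root_self, map_neg]
  rfl

theorem exists_basis_rootElt (v : D.weylGroup) (i : Fin n) :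
    ∃ (k : ℕ) (b : Basis (Fin k) ℤ L.carrier) (j : Fin k), b j = L.rootElt v i := by
  obtain ⟨k, b, j, h⟩ := L.exists_basis i
  refine ⟨k, b.map (DistribMulAction.toAddEquiv L.carrier v).toIntLinearEquiv, j, Subtype.ext ?_⟩
  rw [Basis.map_apply, coe_rootElt, ← h]
  rfl

theorem rootReflection_smul (v : D.weylGroup) (i : Fin n) (l : L.carrier) :
    ∃ m : ℤ, D.rootReflection v i • l = l + m • L.rootElt v i := by
  obtain ⟨m, hm⟩ := L.pairing_int _ (L.smul_mem v⁻¹ l.2) i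
  refine ⟨-m, Subtype.ext ?_⟩
  rw [coe_smul, D.rootReflection_apply, hm, Int.cast_smul_eq_zsmul, neg_smul, ← sub_eq_add_neg]
  rfl

theorem rootReflection_smul_rootElt (v : D.weylGroup) (i : Fin n) :
    D.rootReflection v i • L.rootElt v i = -L.rootElt v i :=
  Subtype.ext (D.rootReflection_apply_self v i)

end lattice

section twisted

variable {R : Type*} [CommRing R] (F : FormalGroup R) {n : ℕ} {A : GeneralizedCartanMatrix n}
  {𝔥 : Type*} [AddCommGroup 𝔥] [Module ℂ 𝔥] {D : KacMoodyRootDatum A 𝔥} (L : DemazureLattice D)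

/-! ### The action of the twisted group algebra -/

theorem act_single (w : D.weylGroup) (a q : L.Q F) :
    L.act F (SkewMonoidAlgebra.single w a) q = a * w • q :=
  SkewMonoidAlgebra.sum_single_index (zero_mul _)

theorem act_add (z z' : L.QW F) (q : L.Q F) : L.act F (z + z') q = L.act F z q + L.act F z' q :=
  SkewMonoidAlgebra.sum_add_index' (fun _ => zero_mul _) fun _ _ _ => add_mul _ _ _

theorem act_zero (q : L.Q F) : L.act F 0 q = 0 := SkewMonoidAlgebra.sum_zero_index

theorem act_one (q : L.Q F) : L.act F 1 q = q := by
  rw [SkewMonoidAlgebra.one_def, act_single, one_smul, one_mul]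

theorem act_neg (z : L.QW F) (q : L.Q F) : L.act F (-z) q = -L.act F z q := by
  rw [eq_neg_iff_add_eq_zero, ← act_add, neg_add_cancel, act_zero]

theorem act_sub (z z' : L.QW F) (q : L.Q F) : L.act F (z - z') q = L.act F z q - L.act F z' q := by
  rw [sub_eq_add_neg, act_add, act_neg, sub_eq_add_neg]

theorem act_apply_add (z : L.QW F) (q q' : L.Q F) :
    L.act F z (q + q') = L.act F z q + L.act F z q' := by
  rw [act, act, act, ← SkewMonoidAlgebra.sum_add]
  simp only [smul_add, mul_add]

theorem act_mul (z z' : L.QW F) (q : L.Q F) : L.act F (z * z') q = L.act F z (L.act F z' q) := by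
  induction z using SkewMonoidAlgebra.induction_on with
  | zero => rw [zero_mul, act_zero, act_zero]
  | add z₁ z₂ h₁ h₂ => rw [add_mul, act_add, act_add, h₁, h₂]
  | single w a =>
    induction z' using SkewMonoidAlgebra.induction_on with
    | zero => rw [mul_zero, act_zero, act_single, smul_zero, mul_zero]
    | add z₁ z₂ h₁ h₂ => rw [mul_add, act_add, act_add, act_apply_add, h₁, h₂]
    | single w' a' =>
      rw [SkewMonoidAlgebra.single_mul_single, act_single, act_single, act_single, smul_mul',
        mul_smul, mul_assoc]

theorem act_eq_sum {z : L.QW F} {V : Finset D.weylGroup} (h : z.support ⊆ V) (q : L.Q F) :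
    L.act F z q = ∑ w ∈ V, z.coeff w * w • q := by
  rw [act, SkewMonoidAlgebra.sum_def]
  exact Finsupp.sum_of_support_subset _ h _ fun _ _ => zero_mul _

theorem invX_mul (w : D.weylGroup) (i : Fin n) :
    L.invX F w i * algebraMap (L.S F) (L.Q F) (x F (L.rootElt w i)) = 1 := by
  exact (IsLocalization.mk'_spec (M := L.rootSubmonoid F) (L.Q F) 1 ⟨x F (L.rootElt w i),
    Submonoid.subset_closure ⟨L.rootElt w i, ⟨w, i, rfl⟩, rfl⟩⟩).trans (map_one _)

theorem act_demazureElement (w : D.weylGroup) (i : Fin n) (q : L.Q F) :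
    L.act F (L.demazureElement F w i) q = L.invX F w i * (q - D.rootReflection w i • q) := by
  rw [demazureElement, act_mul, act_single, act_sub, act_one, act_single, one_mul, one_smul]

/-! ### Local regularity of elements of the localization -/

/-- The element `q` of `Q` lies in the localization of `S` at the ideal generated by `x_l`. -/
def IsRegularAt (l : L.carrier) (q : L.Q F) : Prop :=
  ∃ t y : L.S F, ¬ x F l ∣ t ∧ algebraMap (L.S F) (L.Q F) t * q = algebraMap (L.S F) (L.Q F) y

variable {F L} in
theorem IsRegularAt.algebraMap_mul {l : L.carrier} {q : L.Q F} (h : L.IsRegularAt F l q)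
    (y : L.S F) : L.IsRegularAt F l (algebraMap (L.S F) (L.Q F) y * q) := by
  obtain ⟨t, z, ht, hz⟩ := h
  exact ⟨t, y * z, ht, by rw [map_mul, ← hz]; ring⟩

/-- The element `z` of `Q_W` maps `S` to `S`. -/
def Preserves (z : L.QW F) : Prop :=
  ∀ y : L.S F, ∃ y' : L.S F,
    L.act F z (algebraMap (L.S F) (L.Q F) y) = algebraMap (L.S F) (L.Q F) y'

end twisted

variable {R : Type*} [CommRing R] [IsDomain R] (F : FormalGroup R) [F.IsComm] {n : ℕ}
  {A : GeneralizedCartanMatrix n} {𝔥 : Type*} [AddCommGroup 𝔥] [Module ℂ 𝔥]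
  {D : KacMoodyRootDatum A 𝔥} (L : DemazureLattice D)

instance : IsDomain (L.S F) := by
  have := L.finite
  have := L.free
  exact FormalGroupAlgebra.isDomain_of_basis F (Module.Free.chooseBasis ℤ L.carrier)

theorem prime_x_rootElt (v : D.weylGroup) (i : Fin n) : Prime (x F (L.rootElt v i)) := by
  obtain ⟨k, b, j, h⟩ := L.exists_basis_rootElt v i
  rw [← h]
  exact FormalGroupAlgebra.prime_x F b j

theorem x_dvd_rootReflection_smul_sub (v : D.weylGroup) (i : Fin n) (y : L.S F) :
    x F (L.rootElt v i) ∣ D.rootReflection v i • y - y := by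
  obtain ⟨k, b, j, h⟩ := L.exists_basis_rootElt v i
  rw [FormalGroupAlgebra.smul_def, ← h]
  refine FormalGroupAlgebra.x_dvd_map_sub F b (fun l => ?_) y
  rw [h]
  exact L.rootReflection_smul v i l

theorem rootSubmonoid_le_nonZeroDivisors : L.rootSubmonoid F ≤ nonZeroDivisors (L.S F) := by
  rw [rootSubmonoid, Submonoid.closure_le]
  rintro _ ⟨l, ⟨w, i, hl⟩, rfl⟩
  rw [show l = L.rootElt w i from Subtype.ext hl]
  exact mem_nonZeroDivisors_of_ne_zero (L.prime_x_rootElt F w i).ne_zero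

theorem algebraMap_injective : Function.Injective (algebraMap (L.S F) (L.Q F)) :=
  IsLocalization.injective _ (L.rootSubmonoid_le_nonZeroDivisors F)

instance : IsDomain (L.Q F) :=
  IsLocalization.isDomain_of_le_nonZeroDivisors _ (L.rootSubmonoid_le_nonZeroDivisors F)

/-- Denominators are products of primes x_α, removed one at a time: regularity gives t y = x_α z
with t not divisible by x_α, so x_α divides the numerator y. -/
theorem exists_algebraMap_eq {q : L.Q F} (h : ∀ v i, L.IsRegularAt F (L.rootElt v i) q) :
    ∃ y, algebraMap (L.S F) (L.Q F) y = q := by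
  have key : ∀ d ∈ L.rootSubmonoid F, ∀ q, (∀ v i, L.IsRegularAt F (L.rootElt v i) q) →
      (∃ y, algebraMap (L.S F) (L.Q F) y = algebraMap (L.S F) (L.Q F) d * q) →
      ∃ y, algebraMap (L.S F) (L.Q F) y = q := by
    intro d hd
    induction hd using Submonoid.closure_induction with
    | mem d hd =>
      rintro q hq ⟨y, hy⟩
      obtain ⟨l, ⟨w, i, hl⟩, rfl⟩ := hd
      rw [show l = L.rootElt w i from Subtype.ext hl] at hy
      obtain ⟨t, z, ht, hz⟩ := hq w i
      have hp := L.prime_x_rootElt F w i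
      have e : t * y = x F (L.rootElt w i) * z := by
        refine L.algebraMap_injective F ?_
        rw [map_mul, map_mul, hy, ← hz]
        ring
      obtain ⟨y', rfl⟩ := (hp.dvd_or_dvd ⟨z, e⟩).resolve_left ht
      refine ⟨y', mul_left_cancel₀ ?_ (by rw [← map_mul]; exact hy)⟩
      exact (map_ne_zero_iff _ (L.algebraMap_injective F)).2 hp.ne_zero
    | one =>
      rintro q - ⟨y, hy⟩
      exact ⟨y, by rw [hy, map_one, one_mul]⟩
    | mul a b _ _ ha hb =>
      rintro q hq ⟨y, hy⟩
      exact hb q hq (ha _ (fun v i => (hq v i).algebraMap_mul b)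
        ⟨y, by rw [hy, map_mul, mul_assoc]⟩)
  obtain ⟨⟨y, d⟩, hy⟩ := IsLocalization.surj (L.rootSubmonoid F) q
  exact key d.1 d.2 q h ⟨y, by rw [← hy, mul_comm]⟩

theorem preserves_of_mem {z : L.QW F} (hz : z ∈ L.formalAffineDemazureAlgebra F) :
    L.Preserves F z := by
  induction hz using Algebra.adjoin_induction with
  | mem z hz =>
    intro y
    obtain ⟨a, rfl⟩ | ⟨w, i, rfl⟩ := hz
    · exact ⟨a * y, by rw [act_single, one_smul, map_mul]⟩
    · obtain ⟨u, hu⟩ := L.x_dvd_rootReflection_smul_sub F w i y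
      refine ⟨-u, ?_⟩
      rw [act_demazureElement, smul_algebraMap, ← map_sub, ← neg_sub, hu, map_neg, map_neg, map_mul,
        mul_neg, ← mul_assoc, invX_mul, one_mul]
  | algebraMap r =>
    refine fun y => ⟨r • y, ?_⟩
    rw [SkewMonoidAlgebra.coe_algebraMap, Function.comp_apply, act_single, one_smul,
      Algebra.smul_def r y, map_mul, ← IsScalarTower.algebraMap_apply]
  | add z z' _ _ h h' =>
    intro y
    obtain ⟨a, ha⟩ := h y
    obtain ⟨b, hb⟩ := h' y
    exact ⟨a + b, by rw [act_add, ha, hb, map_add]⟩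
  | mul z z' _ _ h h' =>
    intro y
    obtain ⟨b, hb⟩ := h' y
    obtain ⟨a, ha⟩ := h b
    exact ⟨a, by rw [act_mul, hb, ha]⟩

end DemazureLattice

end

/-! ### Isolating two coefficients of an operator that preserves `S`. -/

noncomputable section

namespace DemazureLattice

open FormalGroupAlgebra (x smul_x)

variable {R : Type*} [CommRing R] (F : FormalGroup R) {n : ℕ}
  {A : GeneralizedCartanMatrix n} {𝔥 : Type*} [AddCommGroup 𝔥] [Module ℂ 𝔥]
  {D : KacMoodyRootDatum A 𝔥} (L : DemazureLattice D)

/-! ### Regularity of the coefficients of an operator preserving `S` -/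

variable {F L} in
-- Adding w to T replaces the operator by its commutator-like variant z u_w − w(u_w) z, which
-- multiplies the coefficient of δ_v by v(u_w) − w(u_w) and so kills v = w.
theorem Preserves.exists_sum_eq {z : L.QW F} (hz : L.Preserves F z) {V : Finset D.weylGroup}
    (hV : z.support ⊆ V) (u : D.weylGroup → L.S F) (T : Finset D.weylGroup) (y : L.S F) :
    ∃ y', ∑ v ∈ V, z.coeff v * algebraMap (L.S F) (L.Q F)
      ((∏ w ∈ T, (v • u w - w • u w)) * v • y) = algebraMap (L.S F) (L.Q F) y' := by
  classical
  induction T using Finset.induction_on generalizing y with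
  | empty =>
    obtain ⟨y', h⟩ := hz y
    refine ⟨y', ?_⟩
    rw [← h, L.act_eq_sum F hV]
    simp only [Finset.prod_empty, one_mul, smul_algebraMap]
  | insert w T hw ih =>
    obtain ⟨a, ha⟩ := ih (u w * y)
    obtain ⟨b, hb⟩ := ih y
    refine ⟨a - w • u w * b, ?_⟩
    rw [map_sub, map_mul, ← ha, ← hb, Finset.mul_sum, ← Finset.sum_sub_distrib]
    refine Finset.sum_congr rfl fun v _ => ?_
    rw [Finset.prod_insert hw, smul_mul']
    simp only [map_mul, map_sub]
    ring

variable [IsDomain R] [CharZero R] [F.IsComm]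

/-- Otherwise the test elements x_λ with λ = w⁻¹v(α_k) show that w'w⁻¹ moves each v(α_k) by a
multiple of α, so w'w⁻¹ is 1 or s_α. -/
theorem exists_not_x_dvd_smul_sub_smul (v : D.weylGroup) (i : Fin n) {w w' : D.weylGroup}
    (h : w' ≠ w) (h' : w' ≠ D.rootReflection v i * w) :
    ∃ u : L.S F, ¬ x F (L.rootElt v i) ∣ w • u - w' • u := by
  by_contra! hu
  have key : ∀ k, ∃ m : ℤ, (w' * w⁻¹).1 (v.1 (D.root k)) - v.1 (D.root k) =
      m • v.1 (D.root i) := by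
    intro k
    have h1 := hu (x F (L.rootElt (w⁻¹ * v) k))
    rw [smul_x, smul_x, smul_rootElt, smul_rootElt] at h1
    obtain ⟨N, b, j, hb⟩ := L.exists_basis_rootElt v i
    rw [← hb] at h1
    obtain ⟨m, hm⟩ := FormalGroupAlgebra.exists_zsmul_eq_of_x_dvd F b h1
    refine ⟨-m, ?_⟩
    rw [hb, mul_inv_cancel_left, ← mul_assoc] at hm
    have h2 := congrArg (Subtype.val (p := (· ∈ L.carrier))) hm
    rw [neg_smul, eq_neg_iff_add_eq_zero]
    change v.1 (D.root k) - (w' * w⁻¹).1 (v.1 (D.root k)) = m • v.1 (D.root i) at h2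
    rw [← h2]
    abel
  rcases D.eq_one_or_eq_rootReflection key with e | e
  · exact h (mul_inv_eq_one.1 e)
  · exact h' (mul_inv_eq_iff_eq_mul.1 e)

variable {F L} in
-- Every term other than w and s_α w is killed. The constant c is a product of factors not divisible
-- by the prime x_α; nothing of the kind is needed for c'.
theorem Preserves.exists_localization {z : L.QW F} (hz : L.Preserves F z) (v : D.weylGroup)
    (i : Fin n) (w : D.weylGroup) :
    ∃ c c' : L.S F, ¬ x F (L.rootElt v i) ∣ c ∧ ∀ y : L.S F, ∃ y' : L.S F,
      z.coeff w * algebraMap (L.S F) (L.Q F) (c * w • y) +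
        z.coeff (D.rootReflection v i * w) *
          algebraMap (L.S F) (L.Q F) (c' * (D.rootReflection v i * w) • y) =
        algebraMap (L.S F) (L.Q F) y' := by
  classical
  set t := D.rootReflection v i * w with ht
  have htw : w ≠ t := by
    intro e
    have h1 : D.rootReflection v i = 1 := mul_eq_right.1 (ht.symm.trans e.symm)
    have h2 := D.rootReflection_apply_self v i
    rw [h1] at h2
    refine D.root_ne_zero v i ((smul_eq_zero.1 ?_).resolve_left (two_ne_zero (α := ℂ)))
    rw [two_smul]
    exact eq_neg_iff_add_eq_zero.1 h2
  have hex : ∀ w', ∃ u : L.S F, w' ≠ w → w' ≠ t → ¬ x F (L.rootElt v i) ∣ w • u - w' • u := by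
    intro w'
    by_cases h : w' ≠ w ∧ w' ≠ t
    · obtain ⟨u, hu⟩ := L.exists_not_x_dvd_smul_sub_smul F v i h.1 h.2
      exact ⟨u, fun _ _ => hu⟩
    · exact ⟨0, fun h1 h2 => absurd ⟨h1, h2⟩ h⟩
  choose u hu using hex
  let T := z.support \ {w, t}
  refine ⟨∏ w' ∈ T, (w • u w' - w' • u w'), ∏ w' ∈ T, (t • u w' - w' • u w'), ?_, fun y => ?_⟩
  · intro hd
    obtain ⟨w', hw', hd'⟩ := (L.prime_x_rootElt F v i).exists_mem_finset_dvd hd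
    have := (Finset.mem_sdiff.1 hw').2
    rw [Finset.mem_insert, Finset.mem_singleton, not_or] at this
    exact hu w' this.1 this.2 hd'
  · obtain ⟨y', h⟩ := hz.exists_sum_eq (Finset.subset_union_left (s₂ := {w, t})) u T y
    refine ⟨y', ?_⟩
    rw [← h, ← Finset.sum_pair htw (f := fun v => z.coeff v * algebraMap (L.S F) (L.Q F)
      ((∏ w ∈ T, (v • u w - w • u w)) * v • y))]
    refine Finset.sum_subset Finset.subset_union_right fun v hv hv' => ?_
    have hvT : v ∈ T := Finset.mem_sdiff.2 ⟨(Finset.mem_union.1 hv).resolve_right hv', hv'⟩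
    rw [Finset.prod_eq_zero hvT (sub_self _), zero_mul, map_zero, mul_zero]

variable {F L} in
theorem Preserves.isRegularAt {z : L.QW F} (hz : L.Preserves F z) {v : D.weylGroup} {i : Fin n}
    {w : D.weylGroup} (h : z.coeff (D.rootReflection v i * w) = 0) :
    L.IsRegularAt F (L.rootElt v i) (z.coeff w) := by
  obtain ⟨c, c', hc, h1⟩ := hz.exists_localization v i w
  obtain ⟨y, hy⟩ := h1 1
  refine ⟨c, y, hc, ?_⟩
  rw [← hy, h, zero_mul, add_zero, smul_one, mul_one, mul_comm]

variable {F L} in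
-- Use y = 1 and y = w⁻¹(x_α), which s_α w sends to x_{−α}. Subtracting x_{−α} times the first
-- relation from the second eliminates the coefficient at s_α w and leaves c (x_α − x_{−α}) q_w,
-- where x_α − x_{−α} is x_α times an element not divisible by x_α.
theorem Preserves.isRegularAt_x_mul {z : L.QW F} (hz : L.Preserves F z) (v : D.weylGroup)
    (i : Fin n) (w : D.weylGroup) :
    L.IsRegularAt F (L.rootElt v i)
      (algebraMap (L.S F) (L.Q F) (x F (L.rootElt v i)) * z.coeff w) := by
  obtain ⟨c, c', hc, h1⟩ := hz.exists_localization v i w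
  obtain ⟨y, hy⟩ := h1 1
  obtain ⟨y', hy'⟩ := h1 (w⁻¹ • x F (L.rootElt v i))
  obtain ⟨N, b, j, hb⟩ := L.exists_basis_rootElt v i
  obtain ⟨e, he, hne⟩ := FormalGroupAlgebra.exists_x_sub_x_neg_eq F b j
  rw [hb] at he hne
  refine ⟨c * e, y' - y * x F (-L.rootElt v i), fun hd =>
    ((L.prime_x_rootElt F v i).dvd_or_dvd hd).elim hc hne, ?_⟩
  rw [mul_smul, smul_inv_smul, smul_x, rootReflection_smul_rootElt] at hy'
  rw [smul_one, smul_one, mul_one, mul_one] at hy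
  rw [map_sub, map_mul _ y, ← hy, ← hy']
  have he' := congrArg (algebraMap (L.S F) (L.Q F)) he
  simp only [map_sub, map_mul] at he' ⊢
  linear_combination (-algebraMap (L.S F) (L.Q F) c * z.coeff w) * he'

end DemazureLattice

end

/-! ### Leading terms of Demazure products and descent on the length. -/

noncomputable section

namespace DemazureLattice

open FormalGroupAlgebra (x smul_x)

variable {R : Type*} [CommRing R] (F : FormalGroup R) {n : ℕ}
  {A : GeneralizedCartanMatrix n} {𝔥 : Type*} [AddCommGroup 𝔥] [Module ℂ 𝔥]
  {D : KacMoodyRootDatum A 𝔥} (L : DemazureLattice D)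

/-! ### Products of Demazure elements along words -/

/-- The denominator `x_{α_{i₁}} s_{i₁}(x_{α_{i₂}}) ⋯` of a word. -/
def wordDenom : List (Fin n) → L.S F
  | [] => 1
  | j :: l => x F (L.rootElt 1 j) * D.s j • wordDenom l

/-- The factors are the x_β for β = s_{i₁} ⋯ s_{i_{k−1}}(α_{i_k}), and a root that turns negative at
the k-th letter is exactly this β. -/
theorem x_dvd_wordDenom_of_isPos {v : D.weylGroup} {i : Fin n} {l : List (Fin n)}
    (h : D.IsPos (v.1 (D.root i))) (h' : D.IsPos (-((D.wordProd l)⁻¹).1 (v.1 (D.root i)))) :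
    x F (L.rootElt v i) ∣ L.wordDenom F l := by
  induction l generalizing v with
  | nil =>
    rw [D.wordProd_nil, inv_one] at h'
    exact absurd (h.eq_zero h') (D.root_ne_zero v i)
  | cons j l ih =>
    rw [D.inv_cons_apply] at h'
    rcases D.isPos_or_neg (D.s j * v) i with h1 | h1
    · obtain ⟨y, hy⟩ := ih h1 h'
      rw [wordDenom, hy, smul_mul', smul_x, smul_rootElt, D.s_mul_s_cancel_left]
      exact (dvd_mul_right _ _).mul_left _
    · have e : L.rootElt v i = L.rootElt 1 j := Subtype.ext (D.eq_root_of_isPos_neg h h1)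
      rw [e]
      exact dvd_mul_right _ _

theorem len_lt_or_x_dvd_wordDenom (v : D.weylGroup) (i : Fin n) (l : List (Fin n)) :
    D.len (D.wordProd l) < D.len (D.rootReflection v i * D.wordProd l) ∨
      x F (L.rootElt v i) ∣ L.wordDenom F l := by
  have key : ∀ v : D.weylGroup, D.IsPos (v.1 (D.root i)) →
      D.len (D.wordProd l) < D.len (D.rootReflection v i * D.wordProd l) ∨
        x F (L.rootElt v i) ∣ L.wordDenom F l := by
    intro v hv
    rcases D.isPos_or_neg ((D.wordProd l)⁻¹ * v) i with h | h
    · exact Or.inl (D.len_lt_of_isPos hv h)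
    · exact Or.inr (L.x_dvd_wordDenom_of_isPos F hv h)
  rcases D.isPos_or_neg v i with h | h
  · exact key v h
  -- Passing to v s_i negates the root and keeps the reflection, and x_α divides x_{−α}.
  · have := key (v * D.s i) (by
      rwa [Subgroup.coe_mul, LinearEquiv.mul_apply, D.s_apply_root_self, map_neg])
    rw [D.rootReflection_mul_s, rootElt_mul_s] at this
    exact this.imp_right (FormalGroupAlgebra.x_dvd_x_neg F _).trans

/-- The product `X_{i₁} X_{i₂} ⋯` of a word. -/
def wordElement : List (Fin n) → L.QW F
  | [] => 1
  | j :: l => L.demazureElement F 1 j * wordElement l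

theorem wordElement_mem (l : List (Fin n)) :
    L.wordElement F l ∈ L.formalAffineDemazureAlgebra F := by
  induction l with
  | nil => exact one_mem _
  | cons j l ih => exact mul_mem (Algebra.subset_adjoin (Or.inr ⟨1, j, rfl⟩)) ih

theorem coeff_demazureElement_mul (j : Fin n) (z : L.QW F) (v : D.weylGroup) :
    (L.demazureElement F 1 j * z).coeff v =
      L.invX F 1 j * (z.coeff v - D.s j • z.coeff (D.s j * v)) := by
  have h : D.rootReflection 1 j = D.s j := D.rootReflection_eq_s rfl
  rw [demazureElement, mul_assoc, SkewMonoidAlgebra.coeff_single_one_mul, sub_mul, one_mul,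
    SkewMonoidAlgebra.coeff_sub, Finsupp.sub_apply, SkewMonoidAlgebra.coeff_single_mul, one_mul, h,
    D.inv_s]

theorem len_le_of_coeff_wordElement_ne_zero {l : List (Fin n)} {v : D.weylGroup}
    (h : (L.wordElement F l).coeff v ≠ 0) : D.len v ≤ l.length := by
  induction l generalizing v with
  | nil =>
    rw [wordElement, SkewMonoidAlgebra.coeff_one] at h
    exact D.len_le (Finsupp.single_apply_ne_zero.1 h).1.symm
  | cons j l ih =>
    rw [wordElement, coeff_demazureElement_mul] at h
    rw [List.length_cons]
    by_cases h1 : (L.wordElement F l).coeff v = 0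
    · have h2 : (L.wordElement F l).coeff (D.s j * v) ≠ 0 := fun e => by simp [h1, e] at h
      have := D.len_s_mul_le (D.s j * v) j
      rw [D.s_mul_s_cancel_left] at this
      exact this.trans (Nat.succ_le_succ (ih h2))
    · exact (ih h1).trans (Nat.le_succ _)

/-- Length equal to that of the word is reached only by choosing the reflection term in every
factor. -/
theorem eq_or_len_lt_of_coeff_wordElement_ne_zero {l : List (Fin n)} {v : D.weylGroup}
    (h : (L.wordElement F l).coeff v ≠ 0) : v = D.wordProd l ∨ D.len v < l.length := by
  induction l generalizing v with
  | nil =>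
    rw [wordElement, SkewMonoidAlgebra.coeff_one] at h
    exact Or.inl (Finsupp.single_apply_ne_zero.1 h).1
  | cons j l ih =>
    rw [wordElement, coeff_demazureElement_mul] at h
    rw [List.length_cons]
    by_cases h1 : (L.wordElement F l).coeff v = 0
    · have h2 : (L.wordElement F l).coeff (D.s j * v) ≠ 0 := fun e => by simp [h1, e] at h
      refine (ih h2).imp (fun e => ?_) fun hl => ?_
      · rw [D.wordProd_cons, ← e, D.s_mul_s_cancel_left]
      · have := D.len_s_mul_le (D.s j * v) j
        rw [D.s_mul_s_cancel_left] at this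
        omega
    · exact Or.inr (Nat.lt_succ_of_le (L.len_le_of_coeff_wordElement_ne_zero F h1))

/-- Since the word is reduced, its product is too long to occur in the tail, so only the term
−(1/x_j) δ_{s_j} of the first factor contributes; each letter adds one sign. -/
theorem coeff_wordElement_mul_wordDenom {l : List (Fin n)} (hl : D.len (D.wordProd l) = l.length) :
    (L.wordElement F l).coeff (D.wordProd l) * algebraMap (L.S F) (L.Q F) (L.wordDenom F l) =
      (-1) ^ l.length := by
  induction l with
  | nil => simp [wordElement, wordDenom, D.wordProd_nil]
  | cons j l ih =>
    rw [D.wordProd_cons, List.length_cons] at hl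
    have hl' : D.len (D.wordProd l) = l.length :=
      le_antisymm (D.len_le rfl) (by have := D.len_s_mul_le (D.wordProd l) j; omega)
    have h0 : (L.wordElement F l).coeff (D.s j * D.wordProd l) = 0 := by
      by_contra h
      have := L.len_le_of_coeff_wordElement_ne_zero F h
      omega
    have ih' := congrArg (D.s j • ·) (ih hl')
    simp only [smul_mul', smul_algebraMap, smul_pow', smul_neg, smul_one] at ih'
    rw [wordElement, wordDenom, D.wordProd_cons, coeff_demazureElement_mul, h0,
      D.s_mul_s_cancel_left, map_mul, List.length_cons, pow_succ, ← ih']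
    linear_combination (-(D.s j • (L.wordElement F l).coeff (D.wordProd l)) *
      algebraMap (L.S F) (L.Q F) (D.s j • L.wordDenom F l)) * L.invX_mul F 1 j

/-! ### Operators preserving `S` belong to the Demazure algebra -/

variable [IsDomain R] [CharZero R] [F.IsComm]

variable {F L} in
-- At each root, either s_α w is too long to lie in the support and there is no pole, or x_α divides
-- the denominator and absorbs a pole that is at most simple.
theorem Preserves.exists_coeff_mul_wordDenom_eq {z : L.QW F} (hz : L.Preserves F z)
    {l : List (Fin n)} (h : ∀ w, z.coeff w ≠ 0 → D.len w ≤ D.len (D.wordProd l)) :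
    ∃ g, algebraMap (L.S F) (L.Q F) g =
      algebraMap (L.S F) (L.Q F) (L.wordDenom F l) * z.coeff (D.wordProd l) := by
  refine L.exists_algebraMap_eq F fun v i => ?_
  rcases L.len_lt_or_x_dvd_wordDenom F v i l with hlt | ⟨y, hy⟩
  · refine (hz.isRegularAt ?_).algebraMap_mul _
    by_contra h0
    exact absurd (h _ h0) (not_le.2 hlt)
  · rw [hy, mul_comm _ y, map_mul, mul_assoc]
    exact (hz.isRegularAt_x_mul v i _).algebraMap_mul y

variable {F L} in
theorem Preserves.mem {z : L.QW F} (hz : L.Preserves F z) :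
    z ∈ L.formalAffineDemazureAlgebra F := by
  classical
  obtain ⟨N, hN⟩ : ∃ N, ∀ w, z.coeff w ≠ 0 → D.len w < N := by
    obtain ⟨N, hN⟩ := (z.support.image D.len).bddAbove
    refine ⟨N + 1, fun w hw => Nat.lt_succ_of_le (hN ?_)⟩
    exact Finset.mem_image_of_mem _ (SkewMonoidAlgebra.mem_support_iff.2 hw)
  induction N generalizing z with
  | zero =>
    have : z = 0 := SkewMonoidAlgebra.ext fun w => not_not.1 fun h => absurd (hN w h) (by omega)
    rw [this]
    exact zero_mem _
  | succ N ih =>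
    choose l hl hlen using D.exists_reduced
    -- The condition is imposed at length N only, so that g can be chosen on all of W; elsewhere the
    -- value 0 serves.
    have hex : ∀ w, ∃ g : L.S F, D.len w = N → algebraMap (L.S F) (L.Q F) g =
        algebraMap (L.S F) (L.Q F) (L.wordDenom F (l w)) * z.coeff w := by
      intro w
      by_cases hw : D.len w = N
      · have := hz.exists_coeff_mul_wordDenom_eq (l := l w) fun v hv => by
          have := hN v hv
          rw [hl]
          omega
        rw [hl] at this
        exact this.imp fun _ h _ => h
      · exact ⟨0, fun h => absurd h hw⟩
    choose g hg using hex
    -- The scalar (−1)^N g w is z's coefficient at w divided by the leading coefficient of the word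
    -- element, so z' agrees with z at length N and has no longer terms.
    set z' : L.QW F := ∑ w ∈ z.support with D.len w = N,
      SkewMonoidAlgebra.single 1 (algebraMap (L.S F) (L.Q F) ((-1) ^ N * g w)) *
        L.wordElement F (l w) with hz'
    have hmem : z' ∈ L.formalAffineDemazureAlgebra F :=
      sum_mem fun w _ => mul_mem (Algebra.subset_adjoin (Or.inl ⟨_, rfl⟩)) (L.wordElement_mem F _)
    have hcoeff : ∀ v, z'.coeff v = ∑ w ∈ z.support with D.len w = N,
        algebraMap (L.S F) (L.Q F) ((-1) ^ N * g w) * (L.wordElement F (l w)).coeff v := by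
      intro v
      rw [hz', ← SkewMonoidAlgebra.coeffAddEquiv_apply, map_sum, Finsupp.finsetSum_apply]
      exact Finset.sum_congr rfl fun w _ => SkewMonoidAlgebra.coeff_single_one_mul _ _ _
    have hpres : L.Preserves F (z - z') := fun y => by
      obtain ⟨a, ha⟩ := hz y
      obtain ⟨b, hb⟩ := L.preserves_of_mem F hmem y
      exact ⟨a - b, by rw [act_sub, ha, hb, map_sub]⟩
    have hlt : ∀ v, (z - z').coeff v ≠ 0 → D.len v < N := by
      intro v hv
      by_contra! hNv
      refine hv ?_
      -- The other word elements have only shorter terms besides their leading one, so they do not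
      -- interfere at v, whose length is at least N.
      have hoff : ∀ w, D.len w = N → w ≠ v → (L.wordElement F (l w)).coeff v = 0 := by
        intro w hw hwv
        by_contra h
        rcases L.eq_or_len_lt_of_coeff_wordElement_ne_zero F h with e | e
        · exact hwv (by rw [e, hl])
        · rw [hlen] at e
          omega
      rw [SkewMonoidAlgebra.coeff_sub, Finsupp.sub_apply, sub_eq_zero, hcoeff]
      rcases eq_or_ne (z.coeff v) 0 with h0 | h0
      · rw [h0]
        refine (Finset.sum_eq_zero fun w hw => ?_).symm
        rw [Finset.mem_filter, SkewMonoidAlgebra.mem_support_iff] at hw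
        rw [hoff w hw.2 (fun e => hw.1 (e ▸ h0)), mul_zero]
      · have hvN : D.len v = N := le_antisymm (Nat.lt_succ_iff.1 (hN v h0)) hNv
        rw [Finset.sum_eq_single_of_mem v
          (Finset.mem_filter.2 ⟨SkewMonoidAlgebra.mem_support_iff.2 h0, hvN⟩)
          fun w hw hwv => by rw [hoff w (Finset.mem_filter.1 hw).2 hwv, mul_zero]]
        have h1 := L.coeff_wordElement_mul_wordDenom F (l := l v) (by rw [hl, hlen])
        rw [hl, hlen, hvN] at h1
        have h2 : ((-1 : L.Q F) ^ N) * (-1) ^ N = 1 := by rw [← mul_pow]; simp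
        rw [map_mul, hg v hvN, map_pow, map_neg, map_one]
        linear_combination (-(-1 : L.Q F) ^ N * z.coeff v) * h1 - z.coeff v * h2
    rw [← sub_add_cancel z z']
    exact add_mem (ih hpres hlt) hmem

end DemazureLattice

end

theorem theorem4p1 {R : Type*} [CommRing R] [IsDomain R] [CharZero R]
    (F : FormalGroup R) [F.IsComm] {n : ℕ} (A : GeneralizedCartanMatrix n)
    {𝔥 : Type*} [AddCommGroup 𝔥] [Module ℂ 𝔥] (D : KacMoodyRootDatum A 𝔥)
    (L : DemazureLattice D) :
    (L.formalAffineDemazureAlgebra F : Set (L.QW F)) =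
      {z | ∀ y : L.S F, ∃ y' : L.S F,
        L.act F z (algebraMap (L.S F) (L.Q F) y) = algebraMap (L.S F) (L.Q F) y'} :=
  Set.ext fun _ => ⟨L.preserves_of_mem F, DemazureLattice.Preserves.mem⟩
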